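/- Let $n \ge 1$. A *signature* is an element $\varepsilon \in \{+,-\}^n$. An *$\varepsilon$-Cambrian tree* is a directed tree with vertices bijectively labeled by (and identified with) $1,\dots,n$ such that every vertex $v$ with $\varepsilon_v = -$ has one parent and two children and every vertex $v$ with $\varepsilon_v = +$ has one child and two parents (parents are targets of outgoing arcs, children are sources of incoming arcs, and any of these parents and children may be missing, i.e. be an unlabeled leaf), and such that, of the two subtrees attached to the two children of a negative vertex $v$ (resp. to the two parents of a positive vertex $v$), the left one contains only labels smaller than $v$ and the right one only labels larger than $v$. Two $\varepsilon$-Cambrian trees $S,T$ are *twin* if the union of $S$ with the reverse of $T$ (all arcs reversed) has no directed cycle. Let $BC_\varepsilon$ be the number of (ordered) pairs of twin $\varepsilon$-Cambrian trees. Let $\mathrm{switch}(\varepsilon)$ be the set of gaps where $\varepsilon$ switches sign, i.e. of the $g$ with $1 \le g \le n-1$ and $\varepsilon_g \ne \varepsilon_{g+1}$. (1) Among all signatures of length $n$, the alternating signature $\mathrm{alt}_n = (+,-,+,-,\dots)$ minimizes and the constant signature $(+)^n$ maximizes the number of pairs of twin trees: for all $\varepsilon \in \{+,-\}^n$, $$\binom{2n-2}{n-1}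 = BC_{\mathrm{alt}_n} \;\le\; BC_\varepsilon \;\le\; BC_{(+)^n} = \binom{n+1}{1}^{-1}\binom{n+1}{2}^{-1}\sum_{k=1}^{n}\binom{n+1}{k-1}\binom{n+1}{k}\binom{n+1}{k+1},$$ the last value being the $n$-th Baxter number. (2) For all signatures $\varepsilon, \tilde\varepsilon \in \{+,-\}^n$ with $\mathrm{switch}(\varepsilon) \subseteq \mathrm{switch}(\tilde\varepsilon)$ one has $BC_\varepsilon \ge BC_{\tilde\varepsilon}$, and $BC_\varepsilon > BC_{\tilde\varepsilon}$ if moreover $\mathrm{switch}(\tilde\varepsilon) \setminus \mathrm{switch}(\varepsilon)$ contains a gap $g$ with $2 \le g \le n-2$. -/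

import Mathlib

/-- A signature of length `n`: an element of `±^n`. The `i`-th sign, `1 ≤ i ≤ n`, is `ε (i - 1)`. -/
abbrev Signature (n : ℕ) : Type := Fin n → ℤˣ

/-- The constant signature `(+)^n`. -/
def constantSignature (n : ℕ) : Signature n := fun _ => 1

/-- The alternating signature `+ - + - ⋯` of length `n`. -/
def alternatingSignature (n : ℕ) : Signature n := fun i => (-1) ^ (i : ℕ)

/-- The gaps where a signature switches sign. The gap `g`, with `1 ≤ g ≤ n - 1`, lies
between the `g`-th and the `(g+1)`-st signs. -/
def switchGaps {n : ℕ} (ε : Signature n) : Set ℕ :=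
  {g | 1 ≤ g ∧ ∃ h : g < n, ε ⟨g - 1, by omega⟩ ≠ ε ⟨g, h⟩}

/-- The vertex set of the subtree attached to `v` through its neighbour `c`: the vertices
reached from `c` without passing through `v`. -/
def attachedSubtree {V : Type*} (G : SimpleGraph V) (v c : V) : Set V :=
  {u | ∃ p : G.Walk c u, v ∉ p.support}

/-- An `ε`-Cambrian tree. Vertices are identified with their labels, so it is a directed tree on
`Fin n`, and `arc v w` is an arc `v → w` (`w` is a parent of `v`, and `v` a child of `w`).
A negative vertex has one parent and two children, a positive vertex has one child and two
parents, where any of these parents and children may be missing (an unlabelled leaf). The subtrees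
attached to the two children (resp. parents) are the left and the right subtree of the vertex, and
have smaller (resp. larger) labels than it. -/
@[ext]
structure CambrianTree {n : ℕ} (ε : Signature n) where
  /-- The arcs of the directed tree. -/
  arc : Fin n → Fin n → Prop
  /-- There are no loops and no pairs of opposite arcs. -/
  asymm : ∀ v w, arc v w → ¬ arc w v
  /-- The underlying undirected graph is a tree. -/
  isTree : (SimpleGraph.fromRel arc).IsTree
  /-- A negative vertex has at most one parent. -/
  neg_parent : ∀ v, ε v = -1 → ∀ w w', arc v w → arc v w' → w = w'
  /-- Each descendant subtree of a negative vertex lies entirely to its left or to its right. -/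
  neg_side : ∀ v, ε v = -1 → ∀ c, arc c v →
    (∀ u ∈ attachedSubtree (SimpleGraph.fromRel arc) v c, u < v) ∨
      (∀ u ∈ attachedSubtree (SimpleGraph.fromRel arc) v c, v < u)
  /-- A negative vertex has at most one left child and at most one right child. -/
  neg_child : ∀ v, ε v = -1 → ∀ c c', arc c v → arc c' v → (c < v ↔ c' < v) → c = c'
  /-- A positive vertex has at most one child. -/
  pos_child : ∀ v, ε v = 1 → ∀ w w', arc w v → arc w' v → w = w'
  /-- Each ancestor subtree of a positive vertex lies entirely to its left or to its right. -/
  pos_side : ∀ v, ε v = 1 → ∀ c, arc v c →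
    (∀ u ∈ attachedSubtree (SimpleGraph.fromRel arc) v c, u < v) ∨
      (∀ u ∈ attachedSubtree (SimpleGraph.fromRel arc) v c, v < u)
  /-- A positive vertex has at most one left parent and at most one right parent. -/
  pos_parent : ∀ v, ε v = 1 → ∀ c c', arc v c → arc v c' → (c < v ↔ c' < v) → c = c'

/-- Two `ε`-Cambrian trees are twin if the union of the first with the reverse of the second
has no directed cycle. -/
def AreTwin {n : ℕ} {ε : Signature n} (S T : CambrianTree ε) : Prop :=
  ∀ v, ¬ Relation.TransGen (fun u w => S.arc u w ∨ T.arc w u) v v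

/-- The `ε`-Baxter-Cambrian number: the number of (ordered) pairs of twin `ε`-Cambrian trees. -/
noncomputable def baxterCambrianNumber {n : ℕ} (ε : Signature n) : ℕ :=
  Nat.card {P : CambrianTree ε × CambrianTree ε // AreTwin P.1 P.2}

/-! Contracting the largest vertex of a Cambrian tree leaves a Cambrian tree with one vertex fewer.
Conversely, a new largest vertex fits exactly into the slots of the right boundary, the directed
path formed by the vertices lying in no left subtree (`IsBoundary.validSlot_iff`): below the path,
on one of its arcs, or above it. Inserting a negative vertex keeps the part of the path above the
slot, inserting a positive one keeps the part below, and the new vertex becomes the bottom,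
respectively the top (`IsBoundary.next`).

In a twin pair the newest vertex is therefore at the same end of both boundaries, and acyclicity
means that the next vertex takes the slot at that end in exactly one of the two trees
(`IsTwinState.acyclic_child_iff`). So twin pairs form a generating tree with labels `(k, l)`, the
boundary lengths minus one, and root `(0, 0)`. The children of `(k, l)` are `(i, l + 1)` for `i ≤ k`
and `(k + 1, j)` for `j ≤ l` if the sign repeats, and `(i + 1, 0)`, `(0, j + 1)` with the same
ranges if it switches. Hence the Baxter-Cambrian number is the value at `(0, 0)` of `n - 1`
operators `sameOp` or `switchOp` applied to the constant 1 (`baxterCambrianNumber_eq`), and only the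
switches matter.

Both operators preserve inequalities and monotonicity in the labels, and `switchOp f ≤ sameOp f` for
monotone `f`, so switches only lower the count. The inequality is strict away from the origin when
`f` is strictly monotone. Strictness needs one operator acting before (on the constant 1) and
leaving the origin needs one acting after, whence `2 ≤ g ≤ n - 2`.

For the alternating signature the iterates of `switchOp` are sums of binomials
(`switchOp_iterate_one`). For the constant one, the nodes are counted by label and by the numbers of
raises of either parameter, through an explicit weight satisfying the recurrence of the tree
(`baxterWeight_rec`); their total for `p` and `q` raises is the summand `k = p + 1` of the Baxter
number. -/

/-! ### Monotone operators on labels and the effect of a switch -/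

/-- The operator summing a function over the children of a node of the generating tree of twin
pairs, when the new sign agrees with the previous one. -/
def sameOp (f : ℕ → ℕ → ℕ) (k l : ℕ) : ℕ :=
  ∑ i ∈ Finset.range (k + 1), f i (l + 1) + ∑ j ∈ Finset.range (l + 1), f (k + 1) j

/-- The operator summing a function over the children of a node of the generating tree of twin
pairs, when the new sign differs from the previous one. -/
def switchOp (f : ℕ → ℕ → ℕ) (k l : ℕ) : ℕ :=
  ∑ i ∈ Finset.range (k + 1), f (i + 1) 0 + ∑ j ∈ Finset.range (l + 1), f 0 (j + 1)

/-- `switchOp` if there is a switch, `sameOp` otherwise. -/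
def stepOp (s : Bool) : (ℕ → ℕ → ℕ) → ℕ → ℕ → ℕ := if s then switchOp else sameOp

/-- The composition of the first `m` operators prescribed by the sequence `σ` of switches. -/
def growth (σ : ℕ → Bool) : ℕ → (ℕ → ℕ → ℕ) → ℕ → ℕ → ℕ
  | 0, f => f
  | m + 1, f => growth σ m (stepOp (σ m) f)

/-- Monotonicity in both arguments. -/
def MonoBoth (f : ℕ → ℕ → ℕ) : Prop :=
  ∀ ⦃k k' l l' : ℕ⦄, k ≤ k' → l ≤ l' → f k l ≤ f k' l'

/-- Strict monotonicity in both arguments. -/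
def StrictMonoBoth (f : ℕ → ℕ → ℕ) : Prop :=
  MonoBoth f ∧ (∀ k l, f k l < f (k + 1) l) ∧ ∀ k l, f k l < f k (l + 1)

theorem stepOp_mono (s : Bool) {f g : ℕ → ℕ → ℕ} (h : f ≤ g) : stepOp s f ≤ stepOp s g := by
  intro k l
  cases s <;> simp only [stepOp, sameOp, switchOp, if_true, if_false, Bool.false_eq_true] <;>
    exact add_le_add (Finset.sum_le_sum fun i _ => h _ _) (Finset.sum_le_sum fun i _ => h _ _)

theorem growth_mono (σ : ℕ → Bool) (m : ℕ) : ∀ {f g : ℕ → ℕ → ℕ}, f ≤ g →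
    growth σ m f ≤ growth σ m g := by
  induction m with
  | zero => intro f g h; exact h
  | succ m ih => intro f g h; exact ih (stepOp_mono _ h)

theorem MonoBoth.stepOp {f : ℕ → ℕ → ℕ} (hf : MonoBoth f) (s : Bool) :
    MonoBoth (stepOp s f) := by
  intro k k' l l' hk hl
  cases s <;> simp only [_root_.stepOp, sameOp, switchOp, if_true, if_false, Bool.false_eq_true]
  · refine add_le_add ?_ ?_
    · exact (Finset.sum_le_sum fun i _ => hf le_rfl (by omega)).trans
        (Finset.sum_le_sum_of_subset (by simpa using hk))
    · exact (Finset.sum_le_sum fun i _ => hf (by omega) le_rfl).trans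
        (Finset.sum_le_sum_of_subset (by simpa using hl))
  · exact add_le_add (Finset.sum_le_sum_of_subset (by simpa using hk))
      (Finset.sum_le_sum_of_subset (by simpa using hl))

theorem StrictMonoBoth.stepOp {f : ℕ → ℕ → ℕ} (hf : StrictMonoBoth f) (s : Bool) :
    StrictMonoBoth (_root_.stepOp s f) := by
  refine ⟨hf.1.stepOp s, fun k l => ?_, fun k l => ?_⟩
  · cases s <;> simp only [_root_.stepOp, sameOp, switchOp, if_true, if_false, Bool.false_eq_true]
    · refine add_lt_add_of_le_of_lt (Finset.sum_le_sum_of_subset (by simp)) ?_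
      exact Finset.sum_lt_sum_of_nonempty (by simp) fun j _ => hf.2.1 _ _
    · rw [Finset.sum_range_succ _ (k + 1)]
      -- Strict monotonicity makes the value at `(k + 2, 0)` positive, and this is the extra term of
      -- the sum.
      have := hf.2.1 (k + 1) 0
      omega
  · cases s <;> simp only [_root_.stepOp, sameOp, switchOp, if_true, if_false, Bool.false_eq_true]
    · refine add_lt_add_of_lt_of_le ?_ (Finset.sum_le_sum_of_subset (by simp))
      exact Finset.sum_lt_sum_of_nonempty (by simp) fun j _ => hf.2.2 _ _
    · rw [Finset.sum_range_succ _ (l + 1)]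
      have := hf.2.2 0 (l + 1)
      omega

/-- The terms `f (k + 1) 0` and `f 0 (l + 1)` occur in both operators. Cancelling them leaves sums
of equal length, to be compared term by term; the subtraction-free form suits natural numbers. -/
theorem switchOp_add_gain (f : ℕ → ℕ → ℕ) (k l : ℕ) :
    sameOp f k l + (∑ i ∈ Finset.range k, f (i + 1) 0 + ∑ j ∈ Finset.range l, f 0 (j + 1)) =
      switchOp f k l +
        (∑ i ∈ Finset.range k, f (i + 1) (l + 1) + ∑ j ∈ Finset.range l, f (k + 1) (j + 1)) := by
  simp only [sameOp, switchOp]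
  rw [Finset.sum_range_succ' (fun i => f i (l + 1)), Finset.sum_range_succ' (fun j => f (k + 1) j),
    Finset.sum_range_succ (fun i => f (i + 1) 0), Finset.sum_range_succ (fun j => f 0 (j + 1))]
  ring

theorem MonoBoth.switchOp_le_sameOp {f : ℕ → ℕ → ℕ} (hf : MonoBoth f) : switchOp f ≤ sameOp f := by
  intro k l
  change switchOp f k l ≤ sameOp f k l
  have h := switchOp_add_gain f k l
  have h1 : ∑ i ∈ Finset.range k, f (i + 1) 0 ≤ ∑ i ∈ Finset.range k, f (i + 1) (l + 1) :=
    Finset.sum_le_sum fun i _ => hf le_rfl (by omega)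
  have h2 : ∑ j ∈ Finset.range l, f 0 (j + 1) ≤ ∑ j ∈ Finset.range l, f (k + 1) (j + 1) :=
    Finset.sum_le_sum fun i _ => hf (by omega) le_rfl
  omega

/-- At the origin both compared sums are empty, so strictness needs a positive label; either a term
moves strictly up in the first parameter or one does in the second. -/
theorem StrictMonoBoth.switchOp_lt_sameOp {f : ℕ → ℕ → ℕ} (hf : StrictMonoBoth f) {k l : ℕ}
    (h0 : 0 < k + l) : switchOp f k l < sameOp f k l := by
  have h := switchOp_add_gain f k l
  have h1 : ∑ i ∈ Finset.range k, f (i + 1) 0 ≤ ∑ i ∈ Finset.range k, f (i + 1) (l + 1) :=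
    Finset.sum_le_sum fun i _ => hf.1 le_rfl (by omega)
  have h2 : ∑ j ∈ Finset.range l, f 0 (j + 1) ≤ ∑ j ∈ Finset.range l, f (k + 1) (j + 1) :=
    Finset.sum_le_sum fun i _ => hf.1 (by omega) le_rfl
  rcases Nat.eq_zero_or_pos k with rfl | hk
  · have : ∑ j ∈ Finset.range l, f 0 (j + 1) < ∑ j ∈ Finset.range l, f (0 + 1) (j + 1) :=
      Finset.sum_lt_sum_of_nonempty (by simpa using (by omega : l ≠ 0)) fun j _ => hf.2.1 _ _
    omega
  · have : ∑ i ∈ Finset.range k, f (i + 1) 0 < ∑ i ∈ Finset.range k, f (i + 1) (l + 1) :=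
      Finset.sum_lt_sum_of_nonempty (by simpa using hk.ne') fun j _ =>
        (hf.2.2 _ 0).trans_le (hf.1 le_rfl (by omega))
    omega

theorem MonoBoth.stepOp_anti {f : ℕ → ℕ → ℕ} (hf : MonoBoth f) {s s' : Bool} (h : s ≤ s') :
    _root_.stepOp s' f ≤ _root_.stepOp s f := by
  cases s <;> cases s'
  · exact le_rfl
  · exact hf.switchOp_le_sameOp
  · exact absurd h (by decide)
  · exact le_rfl

theorem growth_anti {σ σ' : ℕ → Bool} (m : ℕ) (h : ∀ i < m, σ i ≤ σ' i) :
    ∀ {f : ℕ → ℕ → ℕ}, MonoBoth f → growth σ' m f ≤ growth σ m f := by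
  induction m with
  | zero => intro f _; exact le_rfl
  | succ m ih =>
    intro f hf
    exact (ih (fun i hi => h i (by omega)) (hf.stepOp _)).trans
      (growth_mono σ m (hf.stepOp_anti (h m (by omega))))

theorem growth_congr {σ σ' : ℕ → Bool} (m : ℕ) (h : ∀ i < m, σ i = σ' i) (f : ℕ → ℕ → ℕ) :
    growth σ m f = growth σ' m f := by
  induction m generalizing f with
  | zero => rfl
  | succ m ih =>
    rw [growth, growth, h m (by omega), ih fun i hi => h i (by omega)]

/-- No node has a child labelled `(0, 0)`, so an inequality that is strict off the origin becomes
strict everywhere after one step. -/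
theorem stepOp_lt (s : Bool) {f g : ℕ → ℕ → ℕ} (h : ∀ k l, 0 < k + l → f k l < g k l) (k l : ℕ) :
    stepOp s f k l < stepOp s g k l := by
  cases s <;> simp only [stepOp, sameOp, switchOp, if_true, if_false, Bool.false_eq_true] <;>
    exact add_lt_add (Finset.sum_lt_sum_of_nonempty (by simp) fun i _ => h _ _ (by omega))
      (Finset.sum_lt_sum_of_nonempty (by simp) fun i _ => h _ _ (by omega))

theorem growth_lt (σ : ℕ → Bool) (m : ℕ) : ∀ {f g : ℕ → ℕ → ℕ},
    (∀ k l, 0 < k + l → f k l < g k l) → ∀ k l, growth σ (m + 1) f k l < growth σ (m + 1) g k l := by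
  induction m with
  | zero => intro f g h k l; exact stepOp_lt _ h k l
  | succ m ih => intro f g h k l; exact ih (fun k l _ => stepOp_lt _ h k l) k l

theorem growth_strict_anti {σ σ' : ℕ → Bool} {t : ℕ} (ht : 1 ≤ t) (hs : σ t = false)
    (hs' : σ' t = true) (m : ℕ) (htm : t < m) (h : ∀ i < m, σ i ≤ σ' i) :
    ∀ {f : ℕ → ℕ → ℕ}, StrictMonoBoth f → growth σ' m f 0 0 < growth σ m f 0 0 := by
  induction m with
  | zero => omega
  | succ m ih =>
    intro f hf
    rcases Nat.lt_or_ge t m with htm' | htm'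
    · exact (ih htm' (fun i hi => h i (by omega)) (hf.stepOp _)).trans_le
        (growth_mono σ m (hf.1.stepOp_anti (h m (by omega))) 0 0)
    · obtain rfl : t = m := by omega
      obtain ⟨t, rfl⟩ : ∃ t', t = t' + 1 := ⟨t - 1, by omega⟩
      -- The remaining steps are first all changed to those of `σ`; the strict gain at step `t` is
      -- then carried to the origin by the `t ≥ 1` operators still to be applied.
      refine (growth_anti (t + 1) (fun i hi => h i (by omega)) (hf.1.stepOp _) 0 0).trans_lt ?_
      refine growth_lt σ t (fun k l hkl => ?_) 0 0
      simpa [_root_.stepOp, hs, hs'] using hf.switchOp_lt_sameOp hkl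

theorem stepOp_one (s : Bool) : stepOp s (fun _ _ => 1) = fun k l => k + l + 2 := by
  funext k l
  cases s <;> simp [stepOp, sameOp, switchOp] <;> ring

theorem growth_one_anti {σ σ' : ℕ → Bool} (m : ℕ) (h : ∀ i < m, σ i ≤ σ' i) :
    growth σ' m (fun _ _ => 1) 0 0 ≤ growth σ m (fun _ _ => 1) 0 0 :=
  growth_anti m h (fun _ _ _ _ _ _ => le_rfl) 0 0

theorem growth_one_strict_anti {σ σ' : ℕ → Bool} {t m : ℕ} (ht : 1 ≤ t) (hs : σ t = false)
    (hs' : σ' t = true) (htm : t + 1 < m) (h : ∀ i < m, σ i ≤ σ' i) :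
    growth σ' m (fun _ _ => 1) 0 0 < growth σ m (fun _ _ => 1) 0 0 := by
  -- The innermost step turns the constant 1 into the strictly monotone `k + l + 2`, whether or not
  -- it is a switch; `t + 1 < m` keeps step `t` outside of it.
  obtain ⟨m, rfl⟩ : ∃ m', m = m' + 1 := ⟨m - 1, by omega⟩
  simp only [growth, stepOp_one]
  refine growth_strict_anti ht hs hs' m (by omega) (fun i hi => h i (by omega)) ⟨?_, ?_, ?_⟩
  · intro k k' l l' hk hl; dsimp only; omega
  · intro k l; dsimp only; omega
  · intro k l; dsimp only; omega

/-! ### The alternating signature: central binomial coefficients -/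

theorem growth_const (s : Bool) (m : ℕ) (f : ℕ → ℕ → ℕ) :
    growth (fun _ => s) m f = (stepOp s)^[m] f := by
  induction m generalizing f with
  | zero => rfl
  | succ m ih => rw [growth, ih, Function.iterate_succ_apply]

theorem sum_range_choose_diag (c m k : ℕ) :
    ∑ i ∈ Finset.range (k + 1), (i + 1 + c).choose m + (1 + c).choose (m + 1) =
      (k + 2 + c).choose (m + 1) := by
  induction k with
  | zero =>
    simp only [zero_add, Finset.sum_range_one]
    rw [show 2 + c = (1 + c) + 1 by ring, Nat.choose_succ_succ]
  | succ k ih =>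
    rw [Finset.sum_range_succ, add_right_comm, ih,
      show k + 1 + 2 + c = (k + 2 + c) + 1 by ring, Nat.choose_succ_succ,
      show k + 1 + 1 + c = k + 2 + c by ring, add_comm]

/-- `switchOp` reads its argument only on the two axes, where the correction `(2 * m).choose m`
cancels one binomial. Each remaining sum is a hockey stick, and the two lower ends add up to the
next central binomial coefficient. -/
theorem switchOp_iterate_one (m k l : ℕ) :
    switchOp^[m] (fun _ _ => 1) k l + (2 * m).choose m =
      (k + 2 * m).choose m + (l + 2 * m).choose m := by
  induction m generalizing k l with
  | zero => simp
  | succ m ih =>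
    rw [Function.iterate_succ_apply', switchOp]
    have e1 : ∀ i, switchOp^[m] (fun _ _ => 1) (i + 1) 0 = (i + 1 + 2 * m).choose m := by
      intro i
      have := ih (i + 1) 0
      rw [zero_add] at this
      omega
    have e2 : ∀ i, switchOp^[m] (fun _ _ => 1) 0 (i + 1) = (i + 1 + 2 * m).choose m := by
      intro i
      have := ih 0 (i + 1)
      rw [zero_add] at this
      omega
    simp only [e1, e2]
    have hk := sum_range_choose_diag (2 * m) m k
    have hl := sum_range_choose_diag (2 * m) m l
    have h2 : (2 * (m + 1)).choose (m + 1) = 2 * (1 + 2 * m).choose (m + 1) := by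
      rw [show 2 * (m + 1) = (1 + 2 * m) + 1 by ring, Nat.choose_succ_succ,
        show (1 + 2 * m).choose m = (1 + 2 * m).choose (m + 1) from
          Nat.choose_symm_of_eq_add (by ring)]
      ring
    rw [h2, show k + 2 * (m + 1) = k + 2 + 2 * m by ring,
      show l + 2 * (m + 1) = l + 2 + 2 * m by ring]
    omega

theorem growth_switch_one (m : ℕ) :
    growth (fun _ => true) m (fun _ _ => 1) 0 0 = (2 * m).choose m := by
  have h := switchOp_iterate_one m 0 0
  rw [growth_const, show stepOp true = switchOp from rfl]
  simp only [zero_add] at h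
  omega

/-! ### The constant signature: Baxter numbers -/

theorem cast_choose_add_succ (a q : ℕ) :
    ((a + 1 + q).choose q : ℚ) = (a + 1 + q) / (a + 1) * ((a + q).choose q : ℚ) := by
  have h := Nat.add_one_mul_choose_eq (a + q) a
  rw [show (a + q).choose a = (a + q).choose q from Nat.choose_symm_of_eq_add rfl,
    show (a + q + 1).choose (a + 1) = (a + 1 + q).choose q by
      rw [show a + q + 1 = a + 1 + q by ring]; exact Nat.choose_symm_of_eq_add rfl] at h
  have h' : ((a : ℚ) + q + 1) * ((a + q).choose q : ℚ) = ((a + 1 + q).choose q : ℚ) * (a + 1) := by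
    exact_mod_cast h
  field_simp
  linarith

theorem cast_choose_add_succ' (a q : ℕ) :
    ((a + (q + 1)).choose (q + 1) : ℚ) = (a + q + 1) / (q + 1) * ((a + q).choose q : ℚ) := by
  have h := Nat.add_one_mul_choose_eq (a + q) q
  have h' : ((a : ℚ) + q + 1) * ((a + q).choose q : ℚ) =
      ((a + (q + 1)).choose (q + 1) : ℚ) * (q + 1) := by
    rw [← add_assoc]; exact_mod_cast h
  field_simp
  linarith

/-- The number of nodes of type `(p - a, q - b)` at level `p + q` of the generating tree of
Baxter numbers which are reached by `p` steps raising the first parameter and `q` steps raising the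
second one. -/
def baxterWeight (p q a b : ℕ) : ℚ :=
  if p = 0 ∨ q = 0 then if a = 0 ∧ b = 0 then 1 else 0
  else (p + 1 - a) * (q + 1 - b) * (p * q - a * b) /
    ((p + q + 1) * (p + q + 2) * (a + q) * (b + p)) *
    (p + q + 2).choose (p + 1) * (a + q).choose q * (b + p).choose p

theorem baxterWeight_symm (p q a b : ℕ) : baxterWeight p q a b = baxterWeight q p b a := by
  unfold baxterWeight
  simp only [or_comm (a := p = 0), and_comm (a := a = 0)]
  rw [show (p + q + 2).choose (p + 1) = (q + p + 2).choose (q + 1) by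
    rw [add_comm q p]; exact Nat.choose_symm_of_eq_add (by ring)]
  split_ifs
  · rfl
  · rfl
  · rw [show (p : ℚ) + q = q + p from add_comm _ _]
    ring

/-- A parameter raised `q` times cannot drop by more than `q`. This boundary value lets sums be
extended by one term for free. -/
theorem baxterWeight_eq_zero (p q a : ℕ) : baxterWeight p q a (q + 1) = 0 := by
  unfold baxterWeight
  split_ifs <;> simp_all

/-- The right side is an antidifference of the weight in `a`: induction on `a` leaves a rational
identity once `cast_choose_add_succ` has made the binomials agree. The bound on `b` serves the case
`q = 0`, where the weight is an indicator and `b` can only be 0 or 1. -/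
theorem sum_baxterWeight (p q a b : ℕ) (hb : b ≤ q + 1) :
    ∑ a' ∈ Finset.range (a + 1), baxterWeight (p + 1) q a' b =
      (q + 1 - b) / ((p + q + 2) * (p + q + 3) * (b + p + 1)) * (p + q + 3).choose (p + 2) *
        (a + q).choose q * (b + (p + 1)).choose (p + 1) *
        ((p + 1) * (p + 2 - q * a / (q + 1)) -
          b * ((p + 2) * a / (q + 1) - a * (a + q + 1) / (q + 2) + a * q / (q + 1))) := by
  rcases Nat.eq_zero_or_pos q with rfl | hq
  · simp only [baxterWeight]
    have hsum : ∑ a' ∈ Finset.range (a + 1), (if a' = 0 ∧ b = 0 then (1 : ℚ) else 0) =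
        if b = 0 then 1 else 0 := by
      by_cases hb : b = 0 <;> simp [hb]
    simp only [or_true, if_true, hsum]
    have hc : (p + 0 + 3).choose (p + 2) = p + 3 := Nat.choose_succ_self_right (p + 2)
    interval_cases b
    · rw [hc]
      simp
      field_simp
    · simp
  · obtain ⟨q, rfl⟩ : ∃ q', q = q' + 1 := ⟨q - 1, by omega⟩
    have hb' : (b : ℚ) + p + 1 ≠ 0 := by positivity
    have hC : (((p + 1) + (q + 1) + 2).choose (p + 1 + 1) : ℚ) =
      ((p + (q + 1) + 3).choose (p + 2) : ℚ) := by
      rw [show p + 1 + (q + 1) + 2 = p + (q + 1) + 3 by ring]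
    have hw : ∀ a', baxterWeight (p + 1) (q + 1) a' b =
        (p + 2 - a') * (q + 2 - b) * ((p + 1) * (q + 1) - a' * b) /
          ((p + q + 3) * (p + q + 4) * (a' + q + 1) * (b + p + 1)) *
        (p + (q + 1) + 3).choose (p + 2) * (a' + (q + 1)).choose (q + 1) *
          (b + (p + 1)).choose (p + 1) := by
      intro a'
      rw [baxterWeight, if_neg (by omega), hC]
      push_cast
      ring
    induction a with
    | zero =>
      simp only [hw, zero_add, Finset.sum_range_one, Nat.choose_self]
      push_cast
      field_simp
      ring
    | succ a ih =>
      rw [Finset.sum_range_succ, ih, hw, cast_choose_add_succ a (q + 1)]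
      push_cast
      field_simp
      ring

/-- The last step to a node raised one parameter and dropped the other by some amount, whence the
two sums over earlier total drops. With both partial sums in closed form and all binomials reduced
to common ones, this is a rational identity. -/
theorem baxterWeight_rec (p q a b : ℕ) (ha : a ≤ p + 1) (hb : b ≤ q + 1) :
    baxterWeight (p + 1) (q + 1) a b =
      ∑ a' ∈ Finset.range (a + 1), baxterWeight (p + 1) q a' b +
        ∑ b' ∈ Finset.range (b + 1), baxterWeight p (q + 1) a b' := by
  simp only [baxterWeight_symm p (q + 1) a]
  rw [sum_baxterWeight p q a b hb, sum_baxterWeight q p b a ha, baxterWeight, if_neg (by omega),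
    cast_choose_add_succ', cast_choose_add_succ']
  have h1 : (q + p + 3).choose (q + 2) = (p + 1 + (q + 2)).choose (q + 2) := by
    rw [show q + p + 3 = p + 1 + (q + 2) by ring]
  have h2 : ((p + q + 3).choose (p + 2) : ℚ) = (q + 2) / (p + 2) *
      (p + 1 + (q + 2)).choose (q + 2) := by
    have h := cast_choose_add_succ' (p + 1) (q + 1)
    have h' := cast_choose_add_succ (p + 1) (q + 1)
    rw [show (p + q + 3).choose (p + 2) = (p + 1 + 1 + (q + 1)).choose (q + 1) by
      rw [show p + q + 3 = (p + 1 + 1) + (q + 1) by ring]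
      exact Nat.choose_symm_of_eq_add (by ring), h']
    rw [show q + 2 = q + 1 + 1 by ring, h]
    push_cast
    field_simp
    ring
  have h3 : ((p + 1 + (q + 1) + 2).choose (p + 1 + 1) : ℚ) = (p + q + 4) / (p + 2) *
      (p + 1 + (q + 2)).choose (q + 2) := by
    have h := cast_choose_add_succ (p + 1) (q + 2)
    rw [show (p + 1 + (q + 1) + 2).choose (p + 1 + 1) = (p + 1 + 1 + (q + 2)).choose (q + 2) by
      rw [show p + 1 + (q + 1) + 2 = (p + 1 + 1) + (q + 2) by ring]
      exact Nat.choose_symm_of_eq_add (by ring), h]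
    push_cast
    field_simp
    ring
  rw [h1, h2, h3]
  have n1 : (a : ℚ) + q + 1 ≠ 0 := by positivity
  have n2 : (b : ℚ) + p + 1 ≠ 0 := by positivity
  push_cast
  field_simp
  ring

/-- Writing `i = p - c` with `a ≤ c ≤ p` and exchanging the sums moves the summation from the test
function to the weights. -/
theorem sum_mul_sum_range_sub (w g : ℕ → ℚ) (p : ℕ) :
    ∑ a ∈ Finset.range (p + 1), w a * ∑ i ∈ Finset.range (p - a + 1), g i =
      ∑ a ∈ Finset.range (p + 1), (∑ a' ∈ Finset.range (a + 1), w a') * g (p - a) := by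
  have h : ∀ a ∈ Finset.range (p + 1), ∑ i ∈ Finset.range (p - a + 1), g i =
      ∑ c ∈ Finset.Ico a (p + 1), g (p - c) := by
    intro a ha
    rw [Finset.mem_range] at ha
    refine Finset.sum_nbij' (fun i => p - i) (fun c => p - c) ?_ ?_ ?_ ?_ ?_ <;>
      intro i hi <;> simp only [Finset.mem_range, Finset.mem_Ico] at hi ⊢
    · omega
    · omega
    · omega
    · omega
    · congr 1; omega
  rw [Finset.sum_congr rfl fun a ha => by rw [h a ha, Finset.mul_sum]]
  simp only [Finset.sum_mul]
  refine Finset.sum_comm' fun a c => ?_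
  simp only [Finset.mem_range, Finset.mem_Ico]
  omega

/-- The sum of a function over the nodes reached by `p` steps raising the first parameter and
`q` steps raising the second one. -/
def weightSum (p q : ℕ) (f : ℕ → ℕ → ℕ) : ℚ :=
  ∑ a ∈ Finset.range (p + 1), ∑ b ∈ Finset.range (q + 1), baxterWeight p q a b * f (p - a) (q - b)

theorem weightSum_raise_right (p q : ℕ) (f : ℕ → ℕ → ℕ) :
    weightSum p q (fun k l => ∑ i ∈ Finset.range (k + 1), f i (l + 1)) =
      ∑ a ∈ Finset.range (p + 1), ∑ b ∈ Finset.range (q + 2),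
        (∑ a' ∈ Finset.range (a + 1), baxterWeight p q a' b) * f (p - a) (q + 1 - b) := by
  rw [weightSum, Finset.sum_comm, Finset.sum_comm (s := Finset.range (p + 1)),
    Finset.sum_range_succ _ (q + 1)]
  simp only [baxterWeight_eq_zero, Finset.sum_const_zero, zero_mul, add_zero]
  refine Finset.sum_congr rfl fun b hb => ?_
  rw [Finset.mem_range] at hb
  have h := sum_mul_sum_range_sub (fun a => baxterWeight p q a b) (fun i => (f i (q + 1 - b) : ℚ)) p
  rw [← h]
  refine Finset.sum_congr rfl fun a _ => ?_
  rw [show q - b + 1 = q + 1 - b by omega]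
  push_cast
  rfl

theorem weightSum_symm (p q : ℕ) (f : ℕ → ℕ → ℕ) :
    weightSum p q f = weightSum q p (fun k l => f l k) := by
  rw [weightSum, weightSum, Finset.sum_comm]
  simp only [baxterWeight_symm p q]

theorem weightSum_raise_left (p q : ℕ) (f : ℕ → ℕ → ℕ) :
    weightSum p q (fun k l => ∑ j ∈ Finset.range (l + 1), f (k + 1) j) =
      ∑ a ∈ Finset.range (p + 2), ∑ b ∈ Finset.range (q + 1),
        (∑ b' ∈ Finset.range (b + 1), baxterWeight p q a b') * f (p + 1 - a) (q - b) := by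
  rw [weightSum_symm, weightSum_raise_right q p (fun k l => f l k), Finset.sum_comm]
  simp only [baxterWeight_symm p q]

theorem weightSum_sameOp (p q : ℕ) (f : ℕ → ℕ → ℕ) :
    weightSum p q (sameOp f) =
      weightSum p q (fun k l => ∑ i ∈ Finset.range (k + 1), f i (l + 1)) +
        weightSum p q (fun k l => ∑ j ∈ Finset.range (l + 1), f (k + 1) j) := by
  simp only [weightSum, sameOp, Nat.cast_add, mul_add, Finset.sum_add_distrib]

theorem weightSum_succ_succ (p q : ℕ) (f : ℕ → ℕ → ℕ) :
    weightSum (p + 1) (q + 1) f =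
      weightSum (p + 1) q (fun k l => ∑ i ∈ Finset.range (k + 1), f i (l + 1)) +
        weightSum p (q + 1) (fun k l => ∑ j ∈ Finset.range (l + 1), f (k + 1) j) := by
  rw [weightSum_raise_right, weightSum_raise_left, weightSum]
  simp only [← Finset.sum_add_distrib]
  refine Finset.sum_congr rfl fun a ha => Finset.sum_congr rfl fun b hb => ?_
  rw [Finset.mem_range] at ha hb
  rw [baxterWeight_rec p q a b (by omega) (by omega), add_mul]

theorem weightSum_zero_succ (q : ℕ) (f : ℕ → ℕ → ℕ) :
    weightSum 0 (q + 1) f =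
      weightSum 0 q (fun k l => ∑ i ∈ Finset.range (k + 1), f i (l + 1)) := by
  rw [weightSum_raise_right, weightSum]
  simp only [zero_add, Finset.sum_range_one]
  simp [baxterWeight]

theorem weightSum_succ_zero (p : ℕ) (f : ℕ → ℕ → ℕ) :
    weightSum (p + 1) 0 f =
      weightSum p 0 (fun k l => ∑ j ∈ Finset.range (l + 1), f (k + 1) j) := by
  rw [weightSum_raise_left, weightSum]
  simp only [zero_add, Finset.sum_range_one]
  simp [baxterWeight]

theorem sameOp_iterate (m : ℕ) (f : ℕ → ℕ → ℕ) :
    (sameOp^[m] f 0 0 : ℚ) =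
      ∑ x ∈ Finset.HasAntidiagonal.antidiagonal m, weightSum x.1 x.2 f := by
  induction m generalizing f with
  | zero => simp [weightSum, baxterWeight]
  | succ m ih =>
    rw [Function.iterate_succ_apply, ih]
    simp only [weightSum_sameOp, Finset.sum_add_distrib]
    -- Extended by zero where the last raise is impossible, so that both sums over the antidiagonal
    -- of `m` become sums over that of `m + 1`.
    set R : ℕ × ℕ → ℚ := fun x => if x.2 = 0 then 0 else
      weightSum x.1 (x.2 - 1) (fun k l => ∑ i ∈ Finset.range (k + 1), f i (l + 1)) with hR
    set T : ℕ × ℕ → ℚ := fun x => if x.1 = 0 then 0 else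
      weightSum (x.1 - 1) x.2 (fun k l => ∑ j ∈ Finset.range (l + 1), f (k + 1) j) with hT
    have h : ∀ x ∈ Finset.HasAntidiagonal.antidiagonal (m + 1),
        weightSum x.1 x.2 f = R x + T x := by
      rintro ⟨p, q⟩ hx
      rw [Finset.HasAntidiagonal.mem_antidiagonal] at hx
      rcases p with _ | p <;> rcases q with _ | q
      · simp at hx
      · simp [hR, hT, weightSum_zero_succ]
      · simp [hR, hT, weightSum_succ_zero]
      · simp [hR, hT, weightSum_succ_succ]
    rw [Finset.sum_congr rfl h, Finset.sum_add_distrib, Finset.Nat.sum_antidiagonal_succ' (f := R),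
      Finset.Nat.sum_antidiagonal_succ (f := T)]
    simp [hR, hT]

/-- Each node `(k, l)` with raises `p, q` has a unique descendant `(1, 0)` through `(0, l + 1)`, and
every node `(1, 0)` with raises `p + 1, q + 1` arises so. The total is thus a single weight; the
proof applies the recurrence twice, one of its two sums vanishing each time. -/
theorem weightSum_one (p q : ℕ) :
    weightSum p q (fun _ _ => 1) = baxterWeight (p + 1) (q + 1) p (q + 1) := by
  rw [baxterWeight_rec p q p (q + 1) (by omega) le_rfl]
  simp only [baxterWeight_eq_zero, Finset.sum_const_zero, zero_add, weightSum, Nat.cast_one,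
    mul_one]
  rw [Finset.sum_comm, Finset.sum_range_succ _ (q + 1), baxterWeight_symm p (q + 1)]
  cases p with
  | zero =>
    simp only [zero_add, Finset.sum_range_one]
    simp [baxterWeight]
  | succ p =>
    have h0 : baxterWeight (q + 1) (p + 1) (q + 1) (p + 1) = 0 := by
      simp only [baxterWeight]; simp
    rw [h0, add_zero]
    refine Finset.sum_congr rfl fun b hb => ?_
    rw [Finset.mem_range] at hb
    rw [baxterWeight_rec p q (p + 1) b le_rfl (by omega)]
    simp only [baxterWeight_symm p (q + 1) (p + 1), baxterWeight_eq_zero, Finset.sum_const_zero,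
      add_zero]

theorem baxterWeight_total (p q : ℕ) :
    baxterWeight (p + 1) (q + 1) p (q + 1) =
      ((p + q + 2).choose 1 : ℚ)⁻¹ * ((p + q + 2).choose 2 : ℚ)⁻¹ *
        ((p + q + 2).choose p * (p + q + 2).choose (p + 1) * (p + q + 2).choose (p + 2)) := by
  have n1 := cast_choose_add_succ p (q + 1)
  have n2 := cast_choose_add_succ' p (q + 1)
  have n3 := cast_choose_add_succ' (p + 1) q
  have n4 := cast_choose_add_succ (p + 1) q
  have n5 := cast_choose_add_succ (p + 1) (q + 2)
  have n6 := cast_choose_add_succ' (p + 1) (q + 1)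
  have e1 : (p + q + 2).choose p = (p + (q + 1 + 1)).choose (q + 1 + 1) := by
    rw [show p + q + 2 = p + (q + 1 + 1) by ring]; exact Nat.choose_symm_of_eq_add rfl
  have e2 : (p + q + 2).choose (p + 1) = (p + 1 + (q + 1)).choose (q + 1) := by
    rw [show p + q + 2 = p + 1 + (q + 1) by ring]; exact Nat.choose_symm_of_eq_add rfl
  have e3 : (p + q + 2).choose (p + 2) = (p + 1 + 1 + q).choose q := by
    rw [show p + q + 2 = p + 1 + 1 + q by ring]; exact Nat.choose_symm_of_eq_add rfl
  have e4 : ((p + q + 2).choose 2 : ℚ) = (p + q + 2) * (p + q + 1) / 2 := by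
    rw [Nat.cast_choose_two]; push_cast; ring
  have e5 : (p + 1 + (q + 1) + 2).choose (p + 1 + 1) = (p + 1 + 1 + (q + 1 + 1)).choose (q + 1 + 1) := by
    rw [show p + 1 + (q + 1) + 2 = p + 1 + 1 + (q + 1 + 1) by ring]
    exact Nat.choose_symm_of_eq_add rfl
  have e6 : (q + 1 + (p + 1)).choose (p + 1) = (p + 1 + (q + 1)).choose (q + 1) := by
    rw [add_comm]; exact Nat.choose_symm_of_eq_add rfl
  rw [baxterWeight, if_neg (by omega), e1, e2, e3, e4, e5, e6, n5, n6, n4, n2]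
  have n7 : ((p + 1 + q).choose q : ℚ) = (q + 1) / (p + 1) * (p + (q + 1)).choose (q + 1) := by
    rw [n1] at n3
    push_cast at n3
    field_simp at n3 ⊢
    have : ((p : ℚ) + q + 2) ≠ 0 := by positivity
    apply mul_left_cancel₀ this
    linarith
  rw [n7, n1, Nat.choose_one_right]
  push_cast
  have hZ : ((p + (q + 1)).choose (q + 1) : ℚ) ≠ 0 := by
    exact_mod_cast (Nat.choose_pos (by omega)).ne'
  field_simp
  ring

theorem growth_same_one (m : ℕ) :
    (growth (fun _ => false) m (fun _ _ => 1) 0 0 : ℚ) =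
      ((m + 2).choose 1 : ℚ)⁻¹ * ((m + 2).choose 2 : ℚ)⁻¹ *
        ∑ k ∈ Finset.Icc 1 (m + 1),
          ((m + 2).choose (k - 1) : ℚ) * ((m + 2).choose k : ℚ) * ((m + 2).choose (k + 1) : ℚ) := by
  rw [growth_const, show stepOp false = sameOp from rfl, sameOp_iterate,
    Finset.Nat.sum_antidiagonal_eq_sum_range_succ_mk, Finset.mul_sum,
    show Finset.Icc 1 (m + 1) = Finset.Ico 1 (m + 2) by ext; simp; omega,
    Finset.sum_Ico_eq_sum_range]
  refine Finset.sum_congr rfl fun p hp => ?_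
  rw [Finset.mem_range] at hp
  obtain ⟨q, rfl⟩ : ∃ q, m = p + q := ⟨m - p, by omega⟩
  rw [show p + q - p = q by omega, weightSum_one, baxterWeight_total]
  rw [show 1 + p - 1 = p by omega, show 1 + p = p + 1 by ring]

/-! ### Cambrian trees as relations on natural numbers -/

/-- `a` and `b` are connected, avoiding `v`, in the graph underlying `r`. -/
def Linked (r : ℕ → ℕ → Prop) (v : ℕ) : ℕ → ℕ → Prop :=
  Relation.ReflTransGen fun x y => (r x y ∨ r y x) ∧ x ≠ v ∧ y ≠ v

/-- `c` is one of the two neighbours of `v` on its branching side: a child of a negative vertex or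
a parent of a positive one. -/
def Dbl (e : ℕ → ℤˣ) (r : ℕ → ℕ → Prop) (v c : ℕ) : Prop :=
  (e v = -1 ∧ r c v) ∨ (e v = 1 ∧ r v c)

/-- `c` is the neighbour of `v` on its non-branching side. -/
def Sgl (e : ℕ → ℤˣ) (r : ℕ → ℕ → Prop) (v c : ℕ) : Prop :=
  (e v = -1 ∧ r v c) ∨ (e v = 1 ∧ r c v)

/-- The arc relation of a Cambrian tree with vertices `0, …, n - 1`, the tree condition being
phrased by connections avoiding a vertex. -/
structure IsCam (e : ℕ → ℤˣ) (n : ℕ) (r : ℕ → ℕ → Prop) : Prop where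
  supp : ∀ {x y}, r x y → x < n ∧ y < n
  asymm : ∀ {x y}, r x y → ¬ r y x
  conn : ∀ {v x y}, n ≤ v → x < n → y < n → Linked r v x y
  acyc : ∀ {v c c'}, r v c ∨ r c v → r v c' ∨ r c' v → Linked r v c c' → c = c'
  sgl : ∀ {v c c'}, Sgl e r v c → Sgl e r v c' → c = c'
  side : ∀ {v c}, Dbl e r v c → (∀ u, Linked r v c u → u < v) ∨ ∀ u, Linked r v c u → v < u
  dbl : ∀ {v c c'}, Dbl e r v c → Dbl e r v c' → (c < v ↔ c' < v) → c = c'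

/-- The vertex `x` does not lie in the left subtree of any vertex. -/
def Exposed (e : ℕ → ℤˣ) (r : ℕ → ℕ → Prop) (x : ℕ) : Prop :=
  ∀ v c, Dbl e r v c → Linked r v c x → v < c

/-- The vertex `x` has room for a parent with larger label. -/
def TopFree (e : ℕ → ℤˣ) (r : ℕ → ℕ → Prop) (x : ℕ) : Prop :=
  ∀ y, r x y → e x = 1 ∧ y < x

/-- The vertex `y` has room for a child with larger label. -/
def BotFree (e : ℕ → ℤˣ) (r : ℕ → ℕ → Prop) (y : ℕ) : Prop :=
  ∀ x, r x y → e y = -1 ∧ x < y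

/-- Insertion of the vertex `N` in `r` with child `a` and parent `b`, subdividing the arc
from `a` to `b`. -/
def ins (r : ℕ → ℕ → Prop) (N : ℕ) (a b : Option ℕ) (x y : ℕ) : Prop :=
  (r x y ∧ ¬ (a = some x ∧ b = some y)) ∨ (a = some x ∧ y = N) ∨ (x = N ∧ b = some y)

/-- Contraction of the vertex `N` in `r`. -/
def con (r : ℕ → ℕ → Prop) (N : ℕ) (x y : ℕ) : Prop :=
  x < N ∧ y < N ∧ (r x y ∨ (r x N ∧ r N y))

theorem units_one_ne_neg_one : (1 : ℤˣ) ≠ -1 := by decide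

theorem Linked.symm {r : ℕ → ℕ → Prop} {v a b : ℕ} (h : Linked r v a b) : Linked r v b a := by
  induction h with
  | refl => exact Relation.ReflTransGen.refl
  | tail _ h ih => exact ih.head ⟨h.1.symm, h.2.2, h.2.1⟩

theorem Linked.single {r : ℕ → ℕ → Prop} {v a b : ℕ} (h : r a b ∨ r b a) (ha : a ≠ v)
    (hb : b ≠ v) : Linked r v a b := Relation.ReflTransGen.single ⟨h, ha, hb⟩

theorem Linked.ne {r : ℕ → ℕ → Prop} {v a b : ℕ} (h : Linked r v a b) (ha : a ≠ v) : b ≠ v := by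
  induction h with
  | refl => exact ha
  | tail _ h _ => exact h.2.2

theorem Linked.lt {r : ℕ → ℕ → Prop} {n v a b : ℕ} (hr : ∀ {x y}, r x y → x < n ∧ y < n)
    (h : Linked r v a b) (ha : a < n) : b < n := by
  induction h with
  | refl => exact ha
  | tail _ h _ => exact h.1.elim (fun h => (hr h).2) fun h => (hr h).1

theorem Dbl.nbr {e : ℕ → ℤˣ} {r : ℕ → ℕ → Prop} {v c : ℕ} (h : Dbl e r v c) : r v c ∨ r c v :=
  h.elim (fun h => Or.inr h.2) fun h => Or.inl h.2

theorem Sgl.nbr {e : ℕ → ℤˣ} {r : ℕ → ℕ → Prop} {v c : ℕ} (h : Sgl e r v c) : r v c ∨ r c v :=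
  h.elim (fun h => Or.inl h.2) fun h => Or.inr h.2

/-- In an acyclic graph the ends of an edge are not connected by the other edges. -/
theorem not_reachable_of_acyc {r : ℕ → ℕ → Prop} (hasymm : ∀ {x y}, r x y → ¬ r y x)
    (hac : ∀ {v c c'}, r v c ∨ r c v → r v c' ∨ r c' v → Linked r v c c' → c = c') {x y : ℕ}
    (hxy : r x y) :
    ¬ Relation.ReflTransGen (fun z w => (r z w ∧ ¬ (z = x ∧ w = y)) ∨
      (r w z ∧ ¬ (w = x ∧ z = y))) x y := by
  intro h
  -- Cut the walk at its last visit to `x`: the rest starts at a neighbour of `x` other than `y` and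
  -- avoids `x`.
  have key : ∀ z, Relation.ReflTransGen (fun z w => (r z w ∧ ¬ (z = x ∧ w = y)) ∨
      (r w z ∧ ¬ (w = x ∧ z = y))) x z → z ≠ x →
      ∃ c, c ≠ y ∧ (r x c ∨ r c x) ∧ Linked r x c z := by
    intro z hz
    induction hz with
    | refl => intro h; exact absurd rfl h
    | @tail z w _ hzw ih =>
      intro hw
      by_cases hzx : z = x
      · subst hzx
        refine ⟨w, ?_, ?_, Relation.ReflTransGen.refl⟩
        · rintro rfl
          rcases hzw with h | h
          · exact h.2 ⟨rfl, rfl⟩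
          · exact hasymm hxy h.1
        · exact hzw.imp And.left And.left
      · obtain ⟨c, hc, hxc, hl⟩ := ih hzx
        exact ⟨c, hc, hxc, hl.tail ⟨hzw.imp And.left And.left, hzx, hw⟩⟩
  have hne : y ≠ x := by rintro rfl; exact hasymm hxy hxy
  obtain ⟨c, hc, hxc, hl⟩ := key y h hne
  exact hc (hac hxc (Or.inl hxy) hl)

/-! ### Insertion and contraction of the largest vertex -/

/-- The data of a slot: a child `a` and a parent `b` for a new vertex `N`. -/
structure SlotData (r : ℕ → ℕ → Prop) (N : ℕ) (a b : Option ℕ) : Prop where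
  supp : ∀ {x y}, r x y → x < N ∧ y < N
  asymm : ∀ {x y}, r x y → ¬ r y x
  ha : ∀ {x}, a = some x → x < N
  hb : ∀ {x}, b = some x → x < N
  ne : ∃ x, a = some x ∨ b = some x
  arc : ∀ {x y}, a = some x → b = some y → r x y

namespace SlotData

variable {e : ℕ → ℤˣ} {r : ℕ → ℕ → Prop} {N : ℕ} {a b : Option ℕ}

theorem ins_supp (S : SlotData r N a b) {x y : ℕ} (h : ins r N a b x y) : x < N + 1 ∧ y < N + 1 := by
  rcases h with ⟨h, _⟩ | ⟨h, h'⟩ | ⟨h', h⟩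
  · have := S.supp h; omega
  · have := S.ha h; omega
  · have := S.hb h; omega

theorem ins_asymm (S : SlotData r N a b) {x y : ℕ} (h : ins r N a b x y) : ¬ ins r N a b y x := by
  have hs := @S.supp
  have has := @S.asymm
  have ha := @S.ha
  have hb := @S.hb
  have harc := @S.arc
  intro h'
  unfold ins at h h'
  grind

theorem ins_lt {x y : ℕ} (hx : x < N) (hy : y < N) :
    ins r N a b x y ↔ r x y ∧ ¬ (a = some x ∧ b = some y) := by
  unfold ins; grind

theorem ins_left (S : SlotData r N a b) {x : ℕ} : ins r N a b x N ↔ a = some x := by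
  have hs := @S.supp
  have hb := @S.hb
  unfold ins; grind

theorem ins_right (S : SlotData r N a b) {x : ℕ} : ins r N a b N x ↔ b = some x := by
  have hs := @S.supp
  have ha := @S.ha
  unfold ins; grind

theorem linked_ins (S : SlotData r N a b) {v x y : ℕ} (hv : v ≠ N) (h : Linked r v x y) :
    Linked (ins r N a b) v x y := by
  induction h with
  | refl => exact Relation.ReflTransGen.refl
  | @tail y z _ hyz ih =>
    refine ih.trans ?_
    have key : ∀ {y z}, r y z → y ≠ v → z ≠ v → Linked (ins r N a b) v y z := by
      intro y z hyz hy hz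
      by_cases h : a = some y ∧ b = some z
      · exact (Linked.single (Or.inl (S.ins_left.2 h.1)) hy hv.symm).trans
          (Linked.single (Or.inl (S.ins_right.2 h.2)) hv.symm hz)
      · exact Linked.single (Or.inl (Or.inl ⟨hyz, h⟩)) hy hz
    rcases hyz.1 with h | h
    · exact key h hyz.2.1 hyz.2.2
    · exact (key h hyz.2.2 hyz.2.1).symm

/-- A passage through `N` enters and leaves by the ends of the slot, so it either returns to the
same vertex or can be replaced by the arc from `a` to `b`. The second clause records the end by
which `N` was entered. -/
theorem linked_of_ins (S : SlotData r N a b) {v x z : ℕ} (hx : x < N) (h : Linked (ins r N a b) v x z) :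
    (z < N → Linked r v x z) ∧
      (z = N → ∃ q, (a = some q ∨ b = some q) ∧ q ≠ v ∧ Linked r v x q) := by
  induction h with
  | refl => exact ⟨fun _ => Relation.ReflTransGen.refl, fun h => absurd h hx.ne⟩
  | @tail z w _ hzw ih =>
    obtain ⟨hzw, hz, hw⟩ := hzw
    rcases Nat.lt_or_ge z N with hzN | hzN
    · have ih := ih.1 hzN
      refine ⟨fun hwN => ih.tail ⟨?_, hz, hw⟩, ?_⟩
      · exact hzw.imp (fun h => ((ins_lt hzN hwN).1 h).1) fun h => ((ins_lt hwN hzN).1 h).1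
      · intro hwN
        rw [hwN] at hzw
        exact ⟨z, hzw.imp S.ins_left.1 S.ins_right.1, hz, ih⟩
    · obtain rfl : z = N := by
        have : z < N + 1 := hzw.elim (fun h => (S.ins_supp h).1) fun h => (S.ins_supp h).2
        omega
      obtain ⟨q, hq, hqv, hl⟩ := ih.2 rfl
      have hw' : a = some w ∨ b = some w :=
        (hzw.imp S.ins_right.1 S.ins_left.1).symm
      have hwN : w < z := hw'.elim S.ha S.hb
      refine ⟨fun _ => ?_, fun h => absurd h hwN.ne⟩
      by_cases hqw : q = w
      · exact hqw ▸ hl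
      · refine hl.tail ⟨?_, hqv, hw⟩
        have harc := @S.arc
        grind

theorem linked_ins_iff (S : SlotData r N a b) {v x y : ℕ} (hv : v ≠ N) (hx : x < N) (hy : y < N) :
    Linked (ins r N a b) v x y ↔ Linked r v x y :=
  ⟨fun h => (S.linked_of_ins hx h).1 hy, S.linked_ins hv⟩

theorem lift_out (S : SlotData r N a b) {v c : ℕ} (h : r v c) :
    ∃ c', ins r N a b v c' ∧ (c' = c ∨ (c' = N ∧ a = some v ∧ b = some c)) := by
  by_cases hs : a = some v ∧ b = some c
  · exact ⟨N, S.ins_left.2 hs.1, Or.inr ⟨rfl, hs.1, hs.2⟩⟩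
  · exact ⟨c, Or.inl ⟨h, hs⟩, Or.inl rfl⟩

theorem lift_in (S : SlotData r N a b) {v c : ℕ} (h : r c v) :
    ∃ c', ins r N a b c' v ∧ (c' = c ∨ (c' = N ∧ a = some c ∧ b = some v)) := by
  by_cases hs : a = some c ∧ b = some v
  · exact ⟨N, S.ins_right.2 hs.2, Or.inr ⟨rfl, hs.1, hs.2⟩⟩
  · exact ⟨c, Or.inl ⟨h, hs⟩, Or.inl rfl⟩

theorem lift_nbr (S : SlotData r N a b) {v c : ℕ} (h : r v c ∨ r c v) :
    ∃ c', (ins r N a b v c' ∨ ins r N a b c' v) ∧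
      (c' = c ∨ (c' = N ∧ ((a = some v ∧ b = some c) ∨ (a = some c ∧ b = some v)))) := by
  rcases h with h | h
  · obtain ⟨c', h1, h2⟩ := S.lift_out h
    exact ⟨c', Or.inl h1, by tauto⟩
  · obtain ⟨c', h1, h2⟩ := S.lift_in h
    exact ⟨c', Or.inr h1, by tauto⟩

theorem lift_dbl (S : SlotData r N a b) {v c : ℕ} (h : Dbl e r v c) :
    ∃ c', Dbl e (ins r N a b) v c' ∧
      (c' = c ∨ (c' = N ∧ ((a = some v ∧ b = some c) ∨ (a = some c ∧ b = some v)))) := by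
  rcases h with ⟨hv, h⟩ | ⟨hv, h⟩
  · obtain ⟨c', h1, h2⟩ := S.lift_in h
    exact ⟨c', Or.inl ⟨hv, h1⟩, by tauto⟩
  · obtain ⟨c', h1, h2⟩ := S.lift_out h
    exact ⟨c', Or.inr ⟨hv, h1⟩, by tauto⟩

theorem lift_sgl (S : SlotData r N a b) {v c : ℕ} (h : Sgl e r v c) :
    ∃ c', Sgl e (ins r N a b) v c' ∧
      (c' = c ∨ (c' = N ∧ ((a = some v ∧ b = some c) ∨ (a = some c ∧ b = some v)))) := by
  rcases h with ⟨hv, h⟩ | ⟨hv, h⟩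
  · obtain ⟨c', h1, h2⟩ := S.lift_out h
    exact ⟨c', Or.inl ⟨hv, h1⟩, by tauto⟩
  · obtain ⟨c', h1, h2⟩ := S.lift_in h
    exact ⟨c', Or.inr ⟨hv, h1⟩, by tauto⟩

/-- The two ends of a slot both adjacent to the new vertex are distinct. -/
theorem left_ne_right (S : SlotData r N a b) {x : ℕ} (ha : a = some x) : b ≠ some x :=
  fun hb => S.asymm (S.arc ha hb) (S.arc ha hb)

/-- From a neighbour of `v` and its lift, the same vertices can be reached avoiding `v`. -/
theorem linked_lift (S : SlotData r N a b) {v c c' x : ℕ} (hv : v < N)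
    (hc : c' = c ∨ (c' = N ∧ ((a = some v ∧ b = some c) ∨ (a = some c ∧ b = some v))))
    (h : Linked r v c x) : Linked (ins r N a b) v c' x := by
  have h' := S.linked_ins hv.ne h
  rcases hc with rfl | ⟨rfl, hc⟩
  · exact h'
  · have hcv : c ≠ v := by
      rintro rfl
      exact hc.elim (fun h => S.left_ne_right h.1 h.2) fun h => S.left_ne_right h.1 h.2
    refine Linked.symm ((Linked.symm h').tail ⟨?_, hcv, hv.ne'⟩)
    exact hc.elim (fun h => Or.inr (S.ins_right.2 h.2)) fun h => Or.inl (S.ins_left.2 h.1)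

theorem dbl_ins (S : SlotData r N a b) {v c : ℕ} (hv : v < N) (h : Dbl e (ins r N a b) v c) :
    (c < N ∧ Dbl e r v c ∧ ¬ (a = some v ∧ b = some c) ∧ ¬ (a = some c ∧ b = some v)) ∨
      (c = N ∧ ((e v = 1 ∧ a = some v) ∨ (e v = -1 ∧ b = some v))) := by
  have hasymm := @S.asymm
  have harc := @S.arc
  have hs := @S.supp
  unfold Dbl ins at h
  unfold Dbl
  grind

theorem sgl_ins (S : SlotData r N a b) {v c : ℕ} (hv : v < N) (h : Sgl e (ins r N a b) v c) :
    (c < N ∧ Sgl e r v c ∧ ¬ (a = some v ∧ b = some c) ∧ ¬ (a = some c ∧ b = some v)) ∨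
      (c = N ∧ ((e v = -1 ∧ a = some v) ∨ (e v = 1 ∧ b = some v))) := by
  have hasymm := @S.asymm
  have harc := @S.arc
  have hs := @S.supp
  unfold Sgl ins at h
  unfold Sgl
  grind

theorem nbr_ins (S : SlotData r N a b) {v c : ℕ} (hv : v < N)
    (h : ins r N a b v c ∨ ins r N a b c v) :
    (c < N ∧ (r v c ∨ r c v) ∧ ¬ (a = some v ∧ b = some c) ∧ ¬ (a = some c ∧ b = some v)) ∨
      (c = N ∧ (a = some v ∨ b = some v)) := by
  have hasymm := @S.asymm
  have harc := @S.arc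
  have hs := @S.supp
  unfold ins at h
  grind

end SlotData

/-- The slots where a new largest vertex can be inserted. -/
structure ValidSlot (e : ℕ → ℤˣ) (r : ℕ → ℕ → Prop) (a b : Option ℕ) : Prop where
  exposed : ∀ {x}, a = some x ∨ b = some x → Exposed e r x
  top : ∀ {x}, b = none → a = some x → TopFree e r x
  bot : ∀ {x}, a = none → b = some x → BotFree e r x

/-- Being the largest label, `N` may join only right subtrees: exposure of the ends of the slot
ensures this. At an end of the path the freeness conditions prevent a second neighbour of the same
kind; elsewhere `N` replaces a neighbour across the subdivided arc. -/
theorem SlotData.isCam_ins {e : ℕ → ℤˣ} {r : ℕ → ℕ → Prop} {N : ℕ} {a b : Option ℕ}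
    (S : SlotData r N a b) (C : IsCam e N r) (V : ValidSlot e r a b) :
    IsCam e (N + 1) (ins r N a b) where
  supp := S.ins_supp
  asymm := S.ins_asymm
  conn := by
    intro v x y hv hx hy
    have key : ∀ {x}, x < N + 1 → ∃ q < N, Linked (ins r N a b) v x q := by
      intro x hx
      rcases Nat.lt_succ_iff_lt_or_eq.1 hx with h | rfl
      · exact ⟨x, h, Relation.ReflTransGen.refl⟩
      · obtain ⟨q, hq⟩ := S.ne
        have hqx : q < x := hq.elim S.ha S.hb
        refine ⟨q, hqx, Linked.single ?_ (by omega) (by omega)⟩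
        exact (hq.imp S.ins_left.2 S.ins_right.2).symm
    obtain ⟨q, hq, hxq⟩ := key hx
    obtain ⟨q', hq', hyq⟩ := key hy
    exact (hxq.trans (S.linked_ins (by omega) (C.conn (by omega) hq hq'))).trans hyq.symm
  acyc := by
    intro v c c' hc hc' hl
    have hvN : v < N + 1 := hc.elim (fun h => (S.ins_supp h).1) fun h => (S.ins_supp h).2
    rcases Nat.lt_succ_iff_lt_or_eq.1 hvN with hv | rfl
    · have aux : ∀ {c}, c < N → (r v c ∨ r c v) → ¬ (a = some v ∧ b = some c) →
          ¬ (a = some c ∧ b = some v) → (a = some v ∨ b = some v) →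
          ¬ Linked (ins r N a b) v c N := by
        intro c hcN hc h1 h2 h3 hl
        obtain ⟨q, hq, hqv, hlq⟩ := (S.linked_of_ins hcN hl).2 rfl
        have hq' : r v q ∨ r q v := by
          have harc := @S.arc
          grind
        have := C.acyc hc hq' hlq
        grind
      rcases S.nbr_ins hv hc with ⟨hcN, h1, h2, h3⟩ | ⟨hcN, h1⟩ <;>
        rcases S.nbr_ins hv hc' with ⟨hcN', h1', h2', h3'⟩ | ⟨hcN', h1'⟩
      · exact C.acyc h1 h1' ((S.linked_of_ins hcN hl).1 hcN')
      · exact absurd (hcN' ▸ hl) (aux hcN h1 h2 h3 h1')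
      · exact absurd (hcN ▸ hl.symm) (aux hcN' h1' h2' h3' h1)
      · omega
    · have aux : ∀ {x y}, a = some x → b = some y → ¬ Linked (ins r v a b) v x y := by
        intro x y hx hy hl
        refine not_reachable_of_acyc (r := r) (fun h => S.asymm h) (fun h => C.acyc h)
          (S.arc hx hy) ?_
        refine Relation.ReflTransGen.mono (fun z w hzw => ?_) _ _ hl
        have hs := @S.ins_supp
        obtain ⟨h, h1, h2⟩ := hzw
        unfold ins at h
        grind
      rw [S.ins_left, S.ins_right] at hc hc'
      rcases hc with hc | hc <;> rcases hc' with hc' | hc'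
      · grind
      · exact absurd hl.symm (aux hc' hc)
      · exact absurd hl (aux hc hc')
      · grind
  sgl := by
    intro v c c' hc hc'
    have hvN : v < N + 1 := hc.nbr.elim (fun h => (S.ins_supp h).1) fun h => (S.ins_supp h).2
    rcases Nat.lt_succ_iff_lt_or_eq.1 hvN with hv | rfl
    · have aux : ∀ {c}, Sgl e r v c → ¬ (a = some v ∧ b = some c) →
          ¬ (a = some c ∧ b = some v) →
          ¬ ((e v = -1 ∧ a = some v) ∨ (e v = 1 ∧ b = some v)) := by
        intro c hc h2 h3 h
        rcases h with ⟨he, ha⟩ | ⟨he, hb⟩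
        · have hc1 : r v c := by unfold Sgl at hc; grind [units_one_ne_neg_one]
          rcases hb : b with _ | y
          · have := (V.top hb ha c hc1).1
            rw [he] at this
            exact absurd this (by decide)
          · have := C.sgl hc (Or.inl ⟨he, S.arc ha hb⟩)
            grind
        · have hc1 : r c v := by unfold Sgl at hc; grind [units_one_ne_neg_one]
          rcases ha : a with _ | y
          · have := (V.bot ha hb c hc1).1
            rw [he] at this
            exact absurd this (by decide)
          · have := C.sgl hc (Or.inr ⟨he, S.arc ha hb⟩)
            grind
      rcases S.sgl_ins hv hc with ⟨hcN, h1, h2, h3⟩ | ⟨hcN, h1⟩ <;>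
        rcases S.sgl_ins hv hc' with ⟨hcN', h1', h2', h3'⟩ | ⟨hcN', h1'⟩
      · exact C.sgl h1 h1'
      · exact absurd h1' (aux h1 h2 h3)
      · exact absurd h1 (aux h1' h2' h3')
      · omega
    · unfold Sgl at hc hc'
      rw [S.ins_left, S.ins_right] at hc hc'
      grind [units_one_ne_neg_one]
  side := by
    intro v c hc
    have hvN : v < N + 1 := hc.nbr.elim (fun h => (S.ins_supp h).1) fun h => (S.ins_supp h).2
    have hlt : c < N + 1 := hc.nbr.elim (fun h => (S.ins_supp h).2) fun h => (S.ins_supp h).1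
    have hcv : c ≠ v := by
      rintro rfl
      exact hc.nbr.elim (fun h => S.ins_asymm h h) fun h => S.ins_asymm h h
    rcases Nat.lt_succ_iff_lt_or_eq.1 hvN with hv | rfl
    · rcases S.dbl_ins hv hc with ⟨hcN, h1, h2, h3⟩ | ⟨hcN, h1⟩
      · by_cases hN : Linked (ins r N a b) v c N
        -- `N` joins this subtree through an end `q` of the slot; exposure of `q` shows that the
        -- subtree was already a right one.
        · obtain ⟨q, hq, hqv, hl⟩ := (S.linked_of_ins hcN hN).2 rfl
          have hvc := V.exposed hq v c h1 hl
          right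
          intro u hu
          rcases Nat.lt_succ_iff_lt_or_eq.1 (Linked.lt S.ins_supp hu hlt) with h | rfl
          · rcases C.side h1 with h' | h'
            · exact absurd (h' c Relation.ReflTransGen.refl) (by omega)
            · exact h' u ((S.linked_of_ins hcN hu).1 h)
          · exact hv
        · have hu : ∀ u, Linked (ins r N a b) v c u → Linked r v c u := by
            intro u hu
            rcases Nat.lt_succ_iff_lt_or_eq.1 (Linked.lt S.ins_supp hu hlt) with h | rfl
            · exact (S.linked_of_ins hcN hu).1 h
            · exact absurd hu hN
          exact (C.side h1).imp (fun h u h' => h u (hu u h')) fun h u h' => h u (hu u h')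
      · right
        subst hcN
        intro u hu
        rcases Nat.lt_succ_iff_lt_or_eq.1 (Linked.lt S.ins_supp hu hlt) with h | rfl
        · obtain ⟨q, hq, hqv, hl⟩ := (S.linked_of_ins h hu.symm).2 rfl
          have hd : Dbl e r v q := by
            have harc := @S.arc
            unfold Dbl
            grind
          have hvq := V.exposed hq v q hd Relation.ReflTransGen.refl
          rcases C.side hd with h' | h'
          · exact absurd (h' q Relation.ReflTransGen.refl) (by omega)
          · exact h' u hl.symm
        · exact hv
    · left
      intro u hu
      have h1 := Linked.lt S.ins_supp hu hlt
      have h2 := hu.ne hcv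
      omega
  dbl := by
    intro v c c' hc hc' hs
    have hvN : v < N + 1 := hc.nbr.elim (fun h => (S.ins_supp h).1) fun h => (S.ins_supp h).2
    rcases Nat.lt_succ_iff_lt_or_eq.1 hvN with hv | rfl
    · have aux : ∀ {c}, Dbl e r v c → ¬ (a = some v ∧ b = some c) →
          ¬ (a = some c ∧ b = some v) → ¬ c < v →
          ¬ ((e v = 1 ∧ a = some v) ∨ (e v = -1 ∧ b = some v)) := by
        intro c hc h2 h3 hcv h
        rcases h with ⟨he, ha⟩ | ⟨he, hb⟩
        · have hc1 : r v c := by unfold Dbl at hc; grind [units_one_ne_neg_one]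
          rcases hb : b with _ | y
          · exact hcv (V.top hb ha c hc1).2
          · have hd : Dbl e r v y := Or.inr ⟨he, S.arc ha hb⟩
            have := V.exposed (Or.inr hb) v y hd Relation.ReflTransGen.refl
            have := C.dbl hc hd (by omega)
            grind
        · have hc1 : r c v := by unfold Dbl at hc; grind [units_one_ne_neg_one]
          rcases ha : a with _ | y
          · exact hcv (V.bot ha hb c hc1).2
          · have hd : Dbl e r v y := Or.inl ⟨he, S.arc ha hb⟩
            have := V.exposed (Or.inl ha) v y hd Relation.ReflTransGen.refl
            have := C.dbl hc hd (by omega)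
            grind
      rcases S.dbl_ins hv hc with ⟨hcN, h1, h2, h3⟩ | ⟨hcN, h1⟩ <;>
        rcases S.dbl_ins hv hc' with ⟨hcN', h1', h2', h3'⟩ | ⟨hcN', h1'⟩
      · exact C.dbl h1 h1' hs
      · exact absurd h1' (aux h1 h2 h3 (by omega))
      · exact absurd h1 (aux h1' h2' h3' (by omega))
      · omega
    · unfold Dbl at hc hc'
      rw [S.ins_left, S.ins_right] at hc hc'
      grind [units_one_ne_neg_one]

/-- Neighbours in `r` lift to neighbours after subdivision, distinct ones to distinct ones, and the
subtree behind a lift contains the old subtree. All conditions are thus inherited. -/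
theorem SlotData.isCam_of_ins {e : ℕ → ℤˣ} {r : ℕ → ℕ → Prop} {N : ℕ} {a b : Option ℕ}
    (S : SlotData r N a b) (C : IsCam e (N + 1) (ins r N a b)) : IsCam e N r where
  supp := S.supp
  asymm := S.asymm
  conn := by
    intro v x y hv hx hy
    have h := (S.linked_ins_iff (by omega) hx hy).1
      (C.conn (le_refl (N + 1)) (by omega) (by omega))
    refine Relation.ReflTransGen.mono (fun z w hzw => ⟨hzw.1, ?_⟩) _ _ h
    have := hzw.1.imp S.supp S.supp
    omega
  acyc := by
    intro v c c' hc hc' hl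
    have hv : v < N := hc.elim (fun h => (S.supp h).1) fun h => (S.supp h).2
    obtain ⟨d, hd, hdc⟩ := S.lift_nbr hc
    obtain ⟨d', hd', hdc'⟩ := S.lift_nbr hc'
    have h3 := C.acyc hd hd' ((S.linked_lift hv hdc hl).trans
      (S.linked_lift hv hdc' Relation.ReflTransGen.refl).symm)
    have hcN : c < N := hc.elim (fun h => (S.supp h).2) fun h => (S.supp h).1
    have hcN' : c' < N := hc'.elim (fun h => (S.supp h).2) fun h => (S.supp h).1
    have hne := @S.left_ne_right
    grind
  sgl := by
    intro v c c' hc hc'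
    have hv : v < N := hc.nbr.elim (fun h => (S.supp h).1) fun h => (S.supp h).2
    obtain ⟨d, hd, hdc⟩ := S.lift_sgl hc
    obtain ⟨d', hd', hdc'⟩ := S.lift_sgl hc'
    have h3 := C.sgl hd hd'
    have hcN : c < N := hc.nbr.elim (fun h => (S.supp h).2) fun h => (S.supp h).1
    have hcN' : c' < N := hc'.nbr.elim (fun h => (S.supp h).2) fun h => (S.supp h).1
    have hne := @S.left_ne_right
    grind
  side := by
    intro v c hc
    have hv : v < N := hc.nbr.elim (fun h => (S.supp h).1) fun h => (S.supp h).2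
    obtain ⟨d, hd, hdc⟩ := S.lift_dbl hc
    exact (C.side hd).imp (fun h u hu => h u (S.linked_lift hv hdc hu))
      fun h u hu => h u (S.linked_lift hv hdc hu)
  dbl := by
    intro v c c' hc hc' hs
    have hv : v < N := hc.nbr.elim (fun h => (S.supp h).1) fun h => (S.supp h).2
    obtain ⟨d, hd, hdc⟩ := S.lift_dbl hc
    obtain ⟨d', hd', hdc'⟩ := S.lift_dbl hc'
    have key : ∀ {c d}, Dbl e (ins r N a b) v d →
        (d = c ∨ (d = N ∧ ((a = some v ∧ b = some c) ∨ (a = some c ∧ b = some v)))) →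
        (d < v ↔ c < v) := by
      intro c d hd hdc
      have hl := S.linked_lift hv hdc Relation.ReflTransGen.refl
      rcases C.side hd with h | h
      · exact iff_of_true (h d Relation.ReflTransGen.refl) (h c hl)
      · have := h d Relation.ReflTransGen.refl
        have := h c hl
        omega
    have h3 := C.dbl hd hd' ((key hd hdc).trans (hs.trans (key hd' hdc').symm))
    have hcN : c < N := hc.nbr.elim (fun h => (S.supp h).2) fun h => (S.supp h).1
    have hcN' : c' < N := hc'.nbr.elim (fun h => (S.supp h).2) fun h => (S.supp h).1
    have hne := @S.left_ne_right
    grind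

/-- A subtree containing an end of the slot acquires `N`, so it cannot be a left one. At a slot with
one end missing, `N` takes the place of a larger parent or child, which must have been free. -/
theorem SlotData.validSlot {e : ℕ → ℤˣ} {r : ℕ → ℕ → Prop} {N : ℕ} {a b : Option ℕ}
    (S : SlotData r N a b) (C : IsCam e (N + 1) (ins r N a b)) : ValidSlot e r a b where
  exposed := by
    intro x hx v c hc hl
    have hv : v < N := hc.nbr.elim (fun h => (S.supp h).1) fun h => (S.supp h).2
    have hcv : c ≠ v := by
      rintro rfl
      exact hc.nbr.elim (fun h => S.asymm h h) fun h => S.asymm h h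
    obtain ⟨d, hd, hdc⟩ := S.lift_dbl hc
    have hN : Linked (ins r N a b) v d N :=
      (S.linked_lift hv hdc hl).tail ⟨hx.imp S.ins_left.2 S.ins_right.2, hl.ne hcv, hv.ne'⟩
    rcases C.side hd with h | h
    · exact absurd (h N hN) (by omega)
    · exact h c (S.linked_lift hv hdc Relation.ReflTransGen.refl)
  top := by
    intro x hb ha y hxy
    have hxN := S.ha ha
    have hyN := (S.supp hxy).2
    have h1 : ins r N a b x N := S.ins_left.2 ha
    have h2 : ins r N a b x y := Or.inl ⟨hxy, by simp [hb]⟩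
    rcases Int.units_eq_one_or (e x) with he | he
    · refine ⟨he, ?_⟩
      by_contra hlt
      have := C.dbl (Or.inr ⟨he, h1⟩) (Or.inr ⟨he, h2⟩) (by omega)
      omega
    · have := C.sgl (Or.inl ⟨he, h1⟩) (Or.inl ⟨he, h2⟩)
      omega
  bot := by
    intro x ha hb y hxy
    have hxN := S.hb hb
    have hyN := (S.supp hxy).1
    have h1 : ins r N a b N x := S.ins_right.2 hb
    have h2 : ins r N a b y x := Or.inl ⟨hxy, by simp [ha]⟩
    rcases Int.units_eq_one_or (e x) with he | he
    · have := C.sgl (Or.inr ⟨he, h1⟩) (Or.inr ⟨he, h2⟩)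
      omega
    · refine ⟨he, ?_⟩
      by_contra hlt
      have := C.dbl (Or.inl ⟨he, h1⟩) (Or.inl ⟨he, h2⟩) (by omega)
      omega

theorem exists_option_of_unique {α : Type*} {p : α → Prop} (h : ∀ {x y}, p x → p y → x = y) :
    ∃ a : Option α, ∀ x, p x ↔ a = some x := by
  by_cases hp : ∃ x, p x
  · obtain ⟨x, hx⟩ := hp
    refine ⟨some x, fun y => ⟨fun hy => congrArg some (h hx hy), fun hy => ?_⟩⟩
    rwa [← Option.some.inj hy]
  · refine ⟨none, fun y => ⟨fun hy => absurd ⟨y, hy⟩ hp, fun hy => by simp at hy⟩⟩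

theorem con_ins {r : ℕ → ℕ → Prop} {N : ℕ} {a b : Option ℕ} (S : SlotData r N a b) :
    con (ins r N a b) N = r := by
  funext x y
  apply propext
  have hs := @S.supp
  constructor
  · rintro ⟨hx, hy, h | ⟨h, h'⟩⟩
    · exact ((SlotData.ins_lt hx hy).1 h).1
    · exact S.arc (S.ins_left.1 h) (S.ins_right.1 h')
  · intro h
    refine ⟨(hs h).1, (hs h).2, ?_⟩
    rw [S.ins_left, S.ins_right, SlotData.ins_lt (hs h).1 (hs h).2]
    tauto

/-- All other labels are smaller than `N`, so on its branching side only the left neighbour can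
exist. Hence `N` has at most one child and one parent, and it subdivides an arc or hangs at an end.
-/
theorem IsCam.exists_slot {e : ℕ → ℤˣ} {r : ℕ → ℕ → Prop} {N : ℕ} (C : IsCam e (N + 1) r)
    (hN : 1 ≤ N) : ∃ a b, SlotData (con r N) N a b ∧ r = ins (con r N) N a b := by
  have hirr : ∀ {x}, ¬ r x x := fun h => C.asymm h h
  have hlt : ∀ {x}, r x N ∨ r N x → x < N := by
    intro x hx
    have h1 : x < N + 1 := hx.elim (fun h => (C.supp h).1) fun h => (C.supp h).2
    have h2 : x ≠ N := by
      rintro rfl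
      exact hx.elim hirr hirr
    omega
  have hin : ∀ {x y}, r x N → r y N → x = y := by
    intro x y hx hy
    rcases Int.units_eq_one_or (e N) with he | he
    · exact C.sgl (Or.inr ⟨he, hx⟩) (Or.inr ⟨he, hy⟩)
    · exact C.dbl (Or.inl ⟨he, hx⟩) (Or.inl ⟨he, hy⟩)
        (iff_of_true (hlt (Or.inl hx)) (hlt (Or.inl hy)))
  have hout : ∀ {x y}, r N x → r N y → x = y := by
    intro x y hx hy
    rcases Int.units_eq_one_or (e N) with he | he
    · exact C.dbl (Or.inr ⟨he, hx⟩) (Or.inr ⟨he, hy⟩)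
        (iff_of_true (hlt (Or.inr hx)) (hlt (Or.inr hy)))
    · exact C.sgl (Or.inl ⟨he, hx⟩) (Or.inl ⟨he, hy⟩)
  obtain ⟨a, ha⟩ := exists_option_of_unique hin
  obtain ⟨b, hb⟩ := exists_option_of_unique hout
  have htri : ∀ {x y}, r x N → r N y → ¬ r x y ∧ ¬ r y x := by
    intro x y hx hy
    have hxN := hlt (Or.inl hx)
    have hyN := hlt (Or.inr hy)
    have hxy : x ≠ y := by
      rintro rfl
      exact C.asymm hx hy
    rw [← not_or]
    intro h
    -- Otherwise `x`, `N`, `y` would form a triangle: `N` and `y` are neighbours of `x` linked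
    -- without it.
    have := C.acyc (Or.inl hx) h
      (Linked.single (Or.inl hy) (by omega) hxy.symm)
    omega
  refine ⟨a, b, ⟨fun h => ⟨h.1, h.2.1⟩, ?_, ?_, ?_, ?_, ?_⟩, ?_⟩
  · rintro x y ⟨hx, hy, h | h⟩ ⟨_, _, h' | h'⟩
    · exact C.asymm h h'
    · exact (htri h'.1 h'.2).2 h
    · exact (htri h.1 h.2).2 h'
    · exact C.asymm h.1 h'.2
  · intro x hx; exact hlt (Or.inl ((ha x).2 hx))
  · intro x hx; exact hlt (Or.inr ((hb x).2 hx))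
  · have h := C.conn (le_refl (N + 1)) (show N < N + 1 by omega) (show 0 < N + 1 by omega)
    rcases Relation.ReflTransGen.cases_head h with h | ⟨x, hx, _⟩
    · omega
    · exact ⟨x, hx.1.symm.imp (ha x).1 (hb x).1⟩
  · intro x y hx hy
    have h1 := (ha x).2 hx
    have h2 := (hb y).2 hy
    exact ⟨hlt (Or.inl h1), hlt (Or.inr h2), Or.inr ⟨h1, h2⟩⟩
  · funext x y
    apply propext
    unfold ins con
    rw [← ha, ← hb]
    constructor
    · intro h
      have hs := C.supp h
      by_cases hx : x = N
      · subst hx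
        exact Or.inr (Or.inr ⟨rfl, h⟩)
      · by_cases hy : y = N
        · subst hy
          exact Or.inr (Or.inl ⟨h, rfl⟩)
        · exact Or.inl ⟨⟨by omega, by omega, Or.inl h⟩, fun h' => (htri h'.1 h'.2).1 h⟩
    · rintro (⟨⟨_, _, h | h⟩, h'⟩ | ⟨h, rfl⟩ | ⟨rfl, h⟩)
      · exact h
      · exact absurd h h'
      · exact h
      · exact h

/-! ### The right boundary and its slots -/

/-- The vertex below the `i`-th slot of the path `w`. -/
def below (w : List ℕ) (i : ℕ) : Option ℕ := if i = 0 then none else w[i - 1]?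

/-- The path bounding the tree on the right after the insertion of `n` in the `i`-th slot
of the path `w`. -/
def nextBoundary (e : ℕ → ℤˣ) (n : ℕ) (w : List ℕ) (i : ℕ) : List ℕ :=
  if e n = -1 then n :: w.drop i else w.take i ++ [n]

/-- The directed path `w` bounds the tree `r` on the right. -/
structure IsBoundary (e : ℕ → ℤˣ) (n : ℕ) (r : ℕ → ℕ → Prop) (w : List ℕ) : Prop where
  nodup : w.Nodup
  lt : ∀ {x}, x ∈ w → x < n
  pos : 0 < w.length
  exposed : ∀ {x}, x < n → (Exposed e r x ↔ x ∈ w)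
  chain : ∀ {i x y}, w[i]? = some x → w[i + 1]? = some y → r x y
  consec : ∀ {i j x y}, w[i]? = some x → w[j]? = some y → r x y → j = i + 1
  bot : ∀ {i x}, w[i]? = some x → (BotFree e r x ↔ i = 0)
  top : ∀ {i x}, w[i]? = some x → (TopFree e r x ↔ i + 1 = w.length)

theorem reflTransGen_of_chain {R : ℕ → ℕ → Prop} {w : List ℕ} {i j x y : ℕ} (hij : i ≤ j)
    (h : ∀ k x y, i ≤ k → k < j → w[k]? = some x → w[k + 1]? = some y → R x y)
    (hx : w[i]? = some x) (hy : w[j]? = some y) : Relation.ReflTransGen R x y := by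
  induction j, hij using Nat.le_induction generalizing y with
  | base =>
    obtain rfl : x = y := by simpa [hx] using hy
    exact Relation.ReflTransGen.refl
  | succ j hij ih =>
    have hj : j < w.length := by
      have := (List.getElem?_eq_some_iff.1 hy).1
      omega
    exact (ih (fun k x y h1 h2 => h k x y h1 (by omega)) (List.getElem?_eq_getElem hj)).tail
      (h j _ _ hij (by omega) (List.getElem?_eq_getElem hj) hy)

theorem getElem?_inj_of_nodup {w : List ℕ} (hw : w.Nodup) {i j x : ℕ} (hi : w[i]? = some x)
    (hj : w[j]? = some x) : i = j := by
  obtain ⟨hi', hi⟩ := List.getElem?_eq_some_iff.1 hi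
  obtain ⟨hj', hj⟩ := List.getElem?_eq_some_iff.1 hj
  exact (hw.getElem_inj_iff).1 (hi.trans hj.symm)

theorem below_eq_some {w : List ℕ} {i x : ℕ} :
    below w i = some x ↔ ∃ j, i = j + 1 ∧ w[j]? = some x := by
  unfold below
  cases i <;> simp

theorem below_eq_none {w : List ℕ} {i : ℕ} (hi : i ≤ w.length) : below w i = none ↔ i = 0 := by
  unfold below
  cases i with
  | zero => simp
  | succ i => simp; omega

theorem IsBoundary.slotData {e : ℕ → ℤˣ} {n : ℕ} {r : ℕ → ℕ → Prop} {w : List ℕ}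
    (B : IsBoundary e n r w) (C : IsCam e n r) {i : ℕ} (hi : i ≤ w.length) :
    SlotData r n (below w i) w[i]? where
  supp := C.supp
  asymm := C.asymm
  ha := by
    intro x hx
    obtain ⟨j, _, hj⟩ := below_eq_some.1 hx
    exact B.lt (List.mem_of_getElem? hj)
  hb := fun hx => B.lt (List.mem_of_getElem? hx)
  ne := by
    have := B.pos
    rcases Nat.lt_or_ge i w.length with h | h
    · exact ⟨w[i], Or.inr (List.getElem?_eq_getElem h)⟩
    · exact ⟨w[i - 1], Or.inl (below_eq_some.2 ⟨i - 1, by omega, List.getElem?_eq_getElem _⟩)⟩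
  arc := by
    intro x y hx hy
    obtain ⟨j, rfl, hj⟩ := below_eq_some.1 hx
    exact B.chain hj hy

/-- The ends of a valid slot are exposed, so they lie on the path. With two ends they are
consecutive by `consec`; a missing child forces the bottom, a missing parent the top. -/
theorem IsBoundary.validSlot_iff {e : ℕ → ℤˣ} {n : ℕ} {r : ℕ → ℕ → Prop} {w : List ℕ}
    (B : IsBoundary e n r w) {a b : Option ℕ} (S : SlotData r n a b) :
    ValidSlot e r a b ↔ ∃ i ≤ w.length, a = below w i ∧ b = w[i]? := by
  have hmem : ∀ {x}, x ∈ w → ∃ i, w[i]? = some x := fun h => List.mem_iff_getElem?.1 h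
  constructor
  · intro V
    have hex : ∀ {x}, a = some x ∨ b = some x → ∃ i, w[i]? = some x := fun h =>
      hmem ((B.exposed (h.elim S.ha S.hb)).1 (V.exposed h))
    rcases ha : a with _ | x <;> rcases hb : b with _ | y
    · obtain ⟨x, hx⟩ := S.ne
      simp [ha, hb] at hx
    · obtain ⟨i, hi⟩ := hex (Or.inr hb)
      obtain rfl := (B.bot hi).1 (V.bot ha hb)
      exact ⟨0, by omega, by simp [below], hi.symm⟩
    · obtain ⟨i, hi⟩ := hex (Or.inl ha)
      have hl := (B.top hi).1 (V.top hb ha)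
      refine ⟨i + 1, by omega, (below_eq_some.2 ⟨i, rfl, hi⟩).symm, ?_⟩
      rw [List.getElem?_eq_none (by omega)]
    · obtain ⟨i, hi⟩ := hex (Or.inl ha)
      obtain ⟨j, hj⟩ := hex (Or.inr hb)
      obtain rfl := B.consec hi hj (S.arc ha hb)
      exact ⟨i + 1, (List.getElem?_eq_some_iff.1 hj).1.le, (below_eq_some.2 ⟨i, rfl, hi⟩).symm,
        hj.symm⟩
  · rintro ⟨i, hi, rfl, rfl⟩
    refine ⟨?_, ?_, ?_⟩
    · intro x hx
      refine (B.exposed (hx.elim S.ha S.hb)).2 ?_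
      rcases hx with hx | hx
      · obtain ⟨j, _, hj⟩ := below_eq_some.1 hx
        exact List.mem_of_getElem? hj
      · exact List.mem_of_getElem? hx
    · intro x hb hx
      obtain ⟨j, rfl, hj⟩ := below_eq_some.1 hx
      rw [List.getElem?_eq_none_iff] at hb
      exact (B.top hj).2 (by omega)
    · intro x ha hx
      exact (B.bot hx).2 ((below_eq_none hi).1 ha)

theorem IsBoundary.ins_chain {e : ℕ → ℤˣ} {n : ℕ} {r : ℕ → ℕ → Prop} {w : List ℕ}
    (B : IsBoundary e n r w) {i k x y : ℕ} (hk : k + 1 ≠ i) (hx : w[k]? = some x)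
    (hy : w[k + 1]? = some y) : ins r n (below w i) w[i]? x y := by
  refine Or.inl ⟨B.chain hx hy, fun h => hk ?_⟩
  exact getElem?_inj_of_nodup B.nodup hy h.2

theorem IsBoundary.linked_ins_chain {e : ℕ → ℤˣ} {n : ℕ} {r : ℕ → ℕ → Prop} {w : List ℕ}
    (B : IsBoundary e n r w) {i j k x y : ℕ} (hjk : j ≤ k) (hi : k < i ∨ i ≤ j)
    (hx : w[j]? = some x) (hy : w[k]? = some y) :
    Linked (ins r n (below w i) w[i]?) n x y := by
  refine reflTransGen_of_chain hjk (fun l x y h1 h2 hx hy => ⟨Or.inl ?_, ?_, ?_⟩) hx hy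
  · exact B.ins_chain (by omega) hx hy
  · exact (B.lt (List.mem_of_getElem? hx)).ne
  · exact (B.lt (List.mem_of_getElem? hy)).ne

/-- Insertion preserves the side of each old subtree, so a left subtree containing `x` would remain
one. -/
theorem exposed_of_exposed_ins {e : ℕ → ℤˣ} {n : ℕ} {r : ℕ → ℕ → Prop} {a b : Option ℕ}
    (S : SlotData r n a b) (C : IsCam e (n + 1) (ins r n a b)) {x : ℕ}
    (h : Exposed e (ins r n a b) x) : Exposed e r x := by
  intro v c hc hl
  have hv : v < n := hc.nbr.elim (fun h => (S.supp h).1) fun h => (S.supp h).2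
  obtain ⟨d, hd, hdc⟩ := S.lift_dbl hc
  have hvd := h v d hd (S.linked_lift hv hdc hl)
  rcases C.side hd with h' | h'
  · exact absurd (h' d Relation.ReflTransGen.refl) (by omega)
  · exact h' c (S.linked_lift hv hdc Relation.ReflTransGen.refl)

theorem exposed_ins_new {e : ℕ → ℤˣ} {n : ℕ} {r : ℕ → ℕ → Prop} (C : IsCam e (n + 1) r) :
    Exposed e r n := by
  intro v c hc hl
  have hv : v < n + 1 := hc.nbr.elim (fun h => (C.supp h).1) fun h => (C.supp h).2
  have hcv : c ≠ v := by
    rintro rfl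
    exact hc.nbr.elim (fun h => C.asymm h h) fun h => C.asymm h h
  have := hl.ne hcv
  rcases C.side hc with h' | h'
  · exact absurd (h' n hl) (by omega)
  · exact h' c Relation.ReflTransGen.refl

/-- At old vertices, subtrees change only by acquiring `n` or by having it as their new root, so
only a subtree attached to `n` itself can hide an exposed vertex. -/
theorem exposed_ins {e : ℕ → ℤˣ} {n : ℕ} {r : ℕ → ℕ → Prop} {a b : Option ℕ}
    (S : SlotData r n a b) {x : ℕ} (hx : x < n) (h : Exposed e r x)
    (hn : ∀ c, Dbl e (ins r n a b) n c → ¬ Linked (ins r n a b) n c x) :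
    Exposed e (ins r n a b) x := by
  intro v c hc hl
  have hv : v < n + 1 := hc.nbr.elim (fun h => (S.ins_supp h).1) fun h => (S.ins_supp h).2
  rcases Nat.lt_succ_iff_lt_or_eq.1 hv with hv | rfl
  · rcases S.dbl_ins hv hc with ⟨hcN, h1, _⟩ | ⟨rfl, _⟩
    · exact h v c h1 ((S.linked_of_ins hcN hl).1 hx)
    · exact hv
  · exact absurd hl (hn c hc)

theorem getElem?_neg_boundary (n : ℕ) (w : List ℕ) (i j : ℕ) :
    (n :: w.drop i)[j]? = if j = 0 then some n else w[i + (j - 1)]? := by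
  cases j <;> simp

theorem getElem?_pos_boundary (n : ℕ) {w : List ℕ} {i : ℕ} (hi : i ≤ w.length) (j : ℕ) :
    (w.take i ++ [n])[j]? = if j < i then w[j]? else if j = i then some n else none := by
  rw [List.getElem?_append, List.length_take, min_eq_left hi, List.getElem?_take]
  split_ifs with h1 h2
  · rfl
  · simp [h2]
  · rw [List.getElem?_eq_none]
    simp
    omega

/-- The path below the slot falls into the left child subtree of `n` and is no longer exposed. What
was above the slot remains attached through the single parent. -/
theorem IsBoundary.next_neg {e : ℕ → ℤˣ} {n : ℕ} {r : ℕ → ℕ → Prop} {w : List ℕ}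
    (B : IsBoundary e n r w) (C : IsCam e n r) {i : ℕ} (hi : i ≤ w.length) (he : e n = -1) :
    IsBoundary e (n + 1) (ins r n (below w i) w[i]?) (n :: w.drop i) := by
  have S := B.slotData C hi
  have C' := S.isCam_ins C ((B.validSlot_iff S).2 ⟨i, hi, rfl, rfl⟩)
  have hn : n ∉ w := fun h => (B.lt h).false
  have hnd : (n :: w.drop i).Nodup :=
    List.nodup_cons.2 ⟨fun h => hn (List.mem_of_mem_drop h), B.nodup.sublist (List.drop_sublist _ _)⟩
  have hbelow : ∀ {k x}, w[i + k]? = some x → below w i ≠ some x := by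
    intro k x hk h
    obtain ⟨j, rfl, hj⟩ := below_eq_some.1 h
    have := getElem?_inj_of_nodup B.nodup hk hj
    omega
  refine ⟨hnd, ?_, by simp, ?_, ?_, ?_, ?_, ?_⟩
  · intro x hx
    rcases List.mem_cons.1 hx with rfl | hx
    · omega
    · have := B.lt (List.mem_of_mem_drop hx)
      omega
  · intro x hx
    rw [List.mem_cons]
    rcases Nat.lt_succ_iff_lt_or_eq.1 hx with hx | rfl
    · constructor
      · intro h
        right
        have hxw := (B.exposed hx).1 (exposed_of_exposed_ins S C' h)
        obtain ⟨j, hj⟩ := List.mem_iff_getElem?.1 hxw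
        rcases Nat.lt_or_ge j i with hji | hji
        · have hi1 : w[i - 1]? = some w[i - 1] := List.getElem?_eq_getElem (by omega)
          have hl := B.linked_ins_chain (i := i) (j := j) (k := i - 1) (by omega)
            (Or.inl (by omega)) hj hi1
          have := h n _ (Or.inl ⟨he, S.ins_left.2 (below_eq_some.2 ⟨i - 1, by omega, hi1⟩)⟩) hl.symm
          have := B.lt (List.mem_of_getElem? hi1)
          omega
        · refine List.mem_of_getElem? (i := j - i) ?_
          rw [List.getElem?_drop, ← hj]
          congr 1; omega
      · rintro (rfl | h)
        · omega
        · refine exposed_ins S hx ((B.exposed hx).2 (List.mem_of_mem_drop h)) fun c hc hl => ?_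
          obtain ⟨j, hj⟩ := List.mem_iff_getElem?.1 h
          rw [List.getElem?_drop] at hj
          have hil := (List.getElem?_eq_some_iff.1 hj).1
          have hi1 : w[i]? = some w[i] := List.getElem?_eq_getElem (by omega)
          have hl' := B.linked_ins_chain (i := i) (j := i) (k := i + j) (by omega)
            (Or.inr le_rfl) hi1 hj
          -- A child of `n` linked to a vertex above the slot would coincide with the parent of `n`.
          have hcb := C'.acyc hc.nbr (Or.inl (S.ins_right.2 hi1)) (hl.trans hl'.symm)
          have hcn : below w i = some c := by
            rcases hc with ⟨_, h⟩ | ⟨h, _⟩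
            · exact S.ins_left.1 h
            · rw [he] at h
              exact absurd h.symm units_one_ne_neg_one
          exact S.left_ne_right hcn (hcb ▸ hi1)
    · exact iff_of_true (exposed_ins_new C') (Or.inl rfl)
  · intro j x y hx hy
    rw [getElem?_neg_boundary] at hx hy
    rw [if_neg (by omega)] at hy
    split_ifs at hx with hj
    · obtain rfl := Option.some.inj hx
      subst hj
      exact S.ins_right.2 hy
    · refine B.ins_chain (k := i + (j - 1)) (by omega) hx ?_
      rw [← hy]
      congr 1; omega
  · intro j k x y hx hy hr
    have hx' := hx
    have hy' := hy
    rw [getElem?_neg_boundary] at hx' hy'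
    split_ifs at hx' hy' with hj hk hk
    · obtain rfl := Option.some.inj hx'
      obtain rfl := Option.some.inj hy'
      exact absurd hr (C'.asymm hr)
    · obtain rfl := Option.some.inj hx'
      have := getElem?_inj_of_nodup B.nodup (S.ins_right.1 hr) hy'
      omega
    · obtain rfl := Option.some.inj hy'
      exact absurd (S.ins_left.1 hr) (hbelow hx')
    · rw [SlotData.ins_lt (B.lt (List.mem_of_getElem? hx')) (B.lt (List.mem_of_getElem? hy'))] at hr
      have := B.consec hx' hy' hr.1
      omega
  · intro j x hx
    rw [getElem?_neg_boundary] at hx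
    split_ifs at hx with hj
    · obtain rfl := Option.some.inj hx
      refine iff_of_true (fun z hz => ⟨he, S.ha (S.ins_left.1 hz)⟩) hj
    · refine iff_of_false (fun h => ?_) hj
      have hxn := B.lt (List.mem_of_getElem? hx)
      by_cases hj1 : j = 1
      · subst hj1
        have := (h n (S.ins_right.2 hx)).2
        omega
      · have := mt (B.bot hx).1 (by omega)
        refine this fun z hz => h z (Or.inl ⟨hz, fun hz' => ?_⟩)
        have := getElem?_inj_of_nodup B.nodup hx hz'.2
        omega
  · intro j x hx
    rw [getElem?_neg_boundary] at hx
    rw [List.length_cons, List.length_drop]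
    split_ifs at hx with hj
    · obtain rfl := Option.some.inj hx
      subst hj
      rcases Nat.lt_or_ge i w.length with hil | hil
      · refine iff_of_false (fun h => ?_) (by omega)
        have := (h w[i] (S.ins_right.2 (List.getElem?_eq_getElem hil))).1
        rw [he] at this
        exact absurd this.symm units_one_ne_neg_one
      · refine iff_of_true (fun z hz => ?_) (by omega)
        have := S.ins_right.1 hz
        rw [List.getElem?_eq_none hil] at this
        simp at this
    · have h1 : TopFree e (ins r n (below w i) w[i]?) x ↔ TopFree e r x := by
        have hxn := B.lt (List.mem_of_getElem? hx)
        constructor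
        · exact fun h z hz => h z (Or.inl ⟨hz, fun h' => hbelow hx h'.1⟩)
        · intro h z hz
          rcases hz with hz | hz | hz
          · exact h z hz.1
          · exact absurd hz.1 (hbelow hx)
          · omega
      rw [h1, B.top hx]
      have := (List.getElem?_eq_some_iff.1 hx).1
      omega

/-- Dually, the path above the slot falls into the left parent subtree of `n`, and `n` becomes the
top. -/
theorem IsBoundary.next_pos {e : ℕ → ℤˣ} {n : ℕ} {r : ℕ → ℕ → Prop} {w : List ℕ}
    (B : IsBoundary e n r w) (C : IsCam e n r) {i : ℕ} (hi : i ≤ w.length) (he : e n = 1) :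
    IsBoundary e (n + 1) (ins r n (below w i) w[i]?) (w.take i ++ [n]) := by
  have S := B.slotData C hi
  have C' := S.isCam_ins C ((B.validSlot_iff S).2 ⟨i, hi, rfl, rfl⟩)
  have hn : n ∉ w := fun h => (B.lt h).false
  have hnd : (w.take i ++ [n]).Nodup :=
    List.nodup_append.2 ⟨B.nodup.sublist (List.take_sublist _ _), by simp, by
      intro x hx y hy
      rw [List.mem_singleton] at hy
      subst hy
      rintro rfl
      exact hn (List.mem_of_mem_take hx)⟩
  have habove : ∀ {k x}, k < i → w[k]? = some x → w[i]? ≠ some x := by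
    intro k x hki hk h
    have := getElem?_inj_of_nodup B.nodup hk h
    omega
  refine ⟨hnd, ?_, by simp, ?_, ?_, ?_, ?_, ?_⟩
  · intro x hx
    rcases List.mem_append.1 hx with hx | hx
    · have := B.lt (List.mem_of_mem_take hx)
      omega
    · rw [List.mem_singleton] at hx
      omega
  · intro x hx
    rw [List.mem_append, List.mem_singleton]
    rcases Nat.lt_succ_iff_lt_or_eq.1 hx with hx | rfl
    · constructor
      · intro h
        left
        have hxw := (B.exposed hx).1 (exposed_of_exposed_ins S C' h)
        obtain ⟨j, hj⟩ := List.mem_iff_getElem?.1 hxw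
        rcases Nat.lt_or_ge j i with hji | hji
        · refine List.mem_of_getElem? (i := j) ?_
          rw [List.getElem?_take, if_pos hji, hj]
        · have hil := (List.getElem?_eq_some_iff.1 hj).1
          have hi1 : w[i]? = some w[i] := List.getElem?_eq_getElem (by omega)
          have hl := B.linked_ins_chain (i := i) (j := i) (k := j) (by omega)
            (Or.inr le_rfl) hi1 hj
          have := h n _ (Or.inr ⟨he, S.ins_right.2 hi1⟩) hl
          have := B.lt (List.mem_of_getElem? hi1)
          omega
      · rintro (h | rfl)
        · refine exposed_ins S hx ((B.exposed hx).2 (List.mem_of_mem_take h)) fun c hc hl => ?_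
          obtain ⟨j, hj⟩ := List.mem_iff_getElem?.1 h
          rw [List.getElem?_take] at hj
          split_ifs at hj with hji
          have hi1 : w[i - 1]? = some w[i - 1] := List.getElem?_eq_getElem (by omega)
          have hb : below w i = some w[i - 1] := below_eq_some.2 ⟨i - 1, by omega, hi1⟩
          have hl' := B.linked_ins_chain (i := i) (j := j) (k := i - 1) (by omega)
            (Or.inl (by omega)) hj hi1
          have hcb := C'.acyc hc.nbr (Or.inr (S.ins_left.2 hb)) (hl.trans hl')
          have hcn : w[i]? = some c := by
            rcases hc with ⟨h, _⟩ | ⟨_, h⟩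
            · rw [he] at h
              exact absurd h units_one_ne_neg_one
            · exact S.ins_right.1 h
          exact S.left_ne_right (hcb ▸ hb) hcn
        · omega
    · exact iff_of_true (exposed_ins_new C') (Or.inr rfl)
  · intro j x y hx hy
    rw [getElem?_pos_boundary n hi] at hx hy
    split_ifs at hx hy with h1 h2 h3 h4 h5
    · exact B.ins_chain (by omega) hx hy
    · obtain rfl := Option.some.inj hy
      exact S.ins_left.2 (below_eq_some.2 ⟨j, by omega, hx⟩)
    · omega
    · omega
  · intro j k x y hx hy hr
    have hx' := hx
    have hy' := hy
    rw [getElem?_pos_boundary n hi] at hx' hy'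
    split_ifs at hx' hy' with h1 h2 h3 h4 h5
    · rw [SlotData.ins_lt (B.lt (List.mem_of_getElem? hx')) (B.lt (List.mem_of_getElem? hy'))] at hr
      exact B.consec hx' hy' hr.1
    · obtain rfl := Option.some.inj hy'
      obtain ⟨l, hl, hl'⟩ := below_eq_some.1 (S.ins_left.1 hr)
      have := getElem?_inj_of_nodup B.nodup hl' hx'
      omega
    · obtain rfl := Option.some.inj hx'
      exact absurd (S.ins_right.1 hr) (habove (by assumption) hy')
    · obtain rfl := Option.some.inj hx'
      obtain rfl := Option.some.inj hy'
      exact absurd hr (C'.asymm hr)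
  · intro j x hx
    rw [getElem?_pos_boundary n hi] at hx
    split_ifs at hx with h1 h2
    · have h1 : BotFree e (ins r n (below w i) w[i]?) x ↔ BotFree e r x := by
        have hxn := B.lt (List.mem_of_getElem? hx)
        constructor
        · exact fun h z hz => h z (Or.inl ⟨hz, fun h' => habove h1 hx h'.2⟩)
        · intro h z hz
          rcases hz with hz | hz | hz
          · exact h z hz.1
          · omega
          · exact absurd hz.2 (habove h1 hx)
      rw [h1, B.bot hx]
    · obtain rfl := Option.some.inj hx
      subst h2
      rcases Nat.eq_zero_or_pos j with hj | hj
      · refine iff_of_true (fun z hz => ?_) hj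
        have := S.ins_left.1 hz
        simp [below, hj] at this
      · refine iff_of_false (fun h => ?_) hj.ne'
        have := (h w[j - 1] (S.ins_left.2 (below_eq_some.2
          ⟨j - 1, by omega, List.getElem?_eq_getElem _⟩))).1
        rw [he] at this
        exact absurd this units_one_ne_neg_one
  · intro j x hx
    rw [getElem?_pos_boundary n hi] at hx
    rw [List.length_append, List.length_take, min_eq_left hi, List.length_singleton]
    split_ifs at hx with h1 h2
    · refine iff_of_false (fun h => ?_) (by omega)
      have hxn := B.lt (List.mem_of_getElem? hx)
      by_cases hj1 : j + 1 = i
      · have := (h n (S.ins_left.2 (below_eq_some.2 ⟨j, hj1.symm, hx⟩))).2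
        omega
      · have := mt (B.top hx).1 (by omega)
        refine this fun z hz => h z (Or.inl ⟨hz, fun hz' => ?_⟩)
        obtain ⟨l, hl, hl'⟩ := below_eq_some.1 hz'.1
        have := getElem?_inj_of_nodup B.nodup hl' hx
        omega
    · obtain rfl := Option.some.inj hx
      refine iff_of_true (fun z hz => ⟨he, S.hb (S.ins_right.1 hz)⟩) (by omega)

theorem IsBoundary.next {e : ℕ → ℤˣ} {n : ℕ} {r : ℕ → ℕ → Prop} {w : List ℕ}
    (B : IsBoundary e n r w) (C : IsCam e n r) {i : ℕ} (hi : i ≤ w.length) :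
    IsBoundary e (n + 1) (ins r n (below w i) w[i]?) (nextBoundary e n w i) := by
  unfold nextBoundary
  split_ifs with he
  · exact B.next_neg C hi he
  · exact B.next_pos C hi ((Int.units_eq_one_or _).resolve_right he)

/-- Both paths have the same vertices. The bottom is the only one with room for a larger child, and
from there `consec` determines each successor. -/
theorem IsBoundary.getElem?_imp {e : ℕ → ℤˣ} {n : ℕ} {r : ℕ → ℕ → Prop} {w w' : List ℕ}
    (B : IsBoundary e n r w) (B' : IsBoundary e n r w') {i x : ℕ} (h : w[i]? = some x) :
    w'[i]? = some x := by
  have key : ∀ {x}, x ∈ w → ∃ j, w'[j]? = some x := fun hx =>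
    List.mem_iff_getElem?.1 ((B'.exposed (B.lt hx)).1 ((B.exposed (B.lt hx)).2 hx))
  induction i generalizing x with
  | zero =>
    obtain ⟨j, hj⟩ := key (List.mem_of_getElem? h)
    obtain rfl := (B'.bot hj).1 ((B.bot h).2 rfl)
    exact hj
  | succ i ih =>
    obtain ⟨j, hj⟩ := key (List.mem_of_getElem? h)
    have hi : w[i]? = some (w[i]'(by have := (List.getElem?_eq_some_iff.1 h).1; omega)) :=
      List.getElem?_eq_getElem _
    obtain rfl := B'.consec (ih hi) hj (B.chain hi h)
    exact hj

theorem IsBoundary.unique {e : ℕ → ℤˣ} {n : ℕ} {r : ℕ → ℕ → Prop} {w w' : List ℕ}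
    (B : IsBoundary e n r w) (B' : IsBoundary e n r w') : w = w' := by
  refine List.ext_getElem? fun i => Option.ext fun x => ⟨?_, ?_⟩
  · exact B.getElem?_imp B'
  · exact B'.getElem?_imp B

/-! ### Building every tree by successive insertions -/

theorem isCam_one_iff {e : ℕ → ℤˣ} {r : ℕ → ℕ → Prop} :
    IsCam e 1 r ↔ r = fun _ _ => False := by
  constructor
  · intro C
    funext x y
    refine eq_false fun h => ?_
    have h1 := C.supp h
    obtain rfl : x = y := by omega
    exact C.asymm h h
  · rintro rfl
    refine ⟨False.elim, False.elim, ?_, ?_, ?_, ?_, ?_⟩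
    · intro v x y _ hx hy
      obtain rfl : x = y := by omega
      exact Relation.ReflTransGen.refl
    · intro v c c' h; simp at h
    · intro v c c' h; simp [Sgl] at h
    · intro v c h; simp [Dbl] at h
    · intro v c c' h; simp [Dbl] at h

theorem isBoundary_one (e : ℕ → ℤˣ) : IsBoundary e 1 (fun _ _ => False) [0] := by
  refine ⟨by simp, by simp, by simp, ?_, ?_, ?_, ?_, ?_⟩
  · intro x hx
    refine iff_of_true ?_ (by simpa using hx)
    intro v c h
    simp [Dbl] at h
  · intro i x y h1 h2; simp at h2
  · intro i j x y h1 h2 h; exact h.elim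
  · intro i x hx
    have := (List.getElem?_eq_some_iff.1 hx).1
    exact iff_of_true (fun y h => h.elim) (by simpa using this)
  · intro i x hx
    have := (List.getElem?_eq_some_iff.1 hx).1
    exact iff_of_true (fun y h => h.elim) (by simpa using this)

/-- Every Cambrian tree on `n + 1` vertices arises from a tree on `n` vertices by insertion in a
slot of its boundary. -/
theorem IsCam.exists_ins {e : ℕ → ℤˣ} {n : ℕ} {r : ℕ → ℕ → Prop} (C : IsCam e (n + 1) r)
    (hn : 1 ≤ n) (hB : ∀ {r}, IsCam e n r → ∃ w, IsBoundary e n r w) :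
    ∃ r₀ w i, IsCam e n r₀ ∧ IsBoundary e n r₀ w ∧ i ≤ w.length ∧
      r = ins r₀ n (below w i) w[i]? := by
  obtain ⟨a, b, S, hr⟩ := C.exists_slot hn
  rw [hr] at C
  have C₀ := S.isCam_of_ins C
  obtain ⟨w, B⟩ := hB C₀
  obtain ⟨i, hi, rfl, rfl⟩ := (B.validSlot_iff S).1 (S.validSlot C)
  exact ⟨_, w, i, C₀, B, hi, hr⟩

theorem IsCam.exists_boundary {e : ℕ → ℤˣ} (n : ℕ) : ∀ {r : ℕ → ℕ → Prop}, IsCam e (n + 1) r →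
    ∃ w, IsBoundary e (n + 1) r w := by
  induction n with
  | zero =>
    intro r C
    obtain rfl := isCam_one_iff.1 C
    exact ⟨[0], isBoundary_one e⟩
  | succ n ih =>
    intro r C
    obtain ⟨r₀, w, i, C₀, B, hi, rfl⟩ := C.exists_ins (by omega) ih
    exact ⟨_, B.next C₀ hi⟩

theorem IsBoundary.isCam_ins {e : ℕ → ℤˣ} {n : ℕ} {r : ℕ → ℕ → Prop} {w : List ℕ}
    (B : IsBoundary e n r w) (C : IsCam e n r) {i : ℕ} (hi : i ≤ w.length) :
    IsCam e (n + 1) (ins r n (below w i) w[i]?) :=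
  (B.slotData C hi).isCam_ins C ((B.validSlot_iff (B.slotData C hi)).2 ⟨i, hi, rfl, rfl⟩)

/-- The parent of the new vertex determines the slot, a missing parent meaning the top one. -/
theorem IsBoundary.slot_inj {e : ℕ → ℤˣ} {n : ℕ} {r : ℕ → ℕ → Prop} {w : List ℕ}
    (B : IsBoundary e n r w) (C : IsCam e n r) {i j : ℕ} (hi : i ≤ w.length) (hj : j ≤ w.length)
    (h : ins r n (below w i) w[i]? = ins r n (below w j) w[j]?) : i = j := by
  have S := B.slotData C hi
  have S' := B.slotData C hj
  have h2 : w[i]? = w[j]? := by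
    refine Option.ext fun x => ?_
    rw [← S.ins_right, h, S'.ins_right]
  rcases Nat.lt_or_ge i w.length with hil | hil
  · rw [List.getElem?_eq_getElem hil] at h2
    exact getElem?_inj_of_nodup B.nodup (List.getElem?_eq_getElem hil) h2.symm
  · rw [List.getElem?_eq_none hil] at h2
    have := List.getElem?_eq_none_iff.1 h2.symm
    omega

/-- The newest vertex is exposed, and its children are all smaller, so it has room for a larger
child; only the bottom of the boundary has this. -/
theorem IsBoundary.last_neg {e : ℕ → ℤˣ} {n : ℕ} {r : ℕ → ℕ → Prop} {w : List ℕ}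
    (B : IsBoundary e (n + 1) r w) (C : IsCam e (n + 1) r) (he : e n = -1) : w[0]? = some n := by
  obtain ⟨i, hi⟩ := List.mem_iff_getElem?.1 ((B.exposed (by omega)).1 (exposed_ins_new C))
  have h : BotFree e r n := fun x hx => ⟨he, by
    have := (C.supp hx).1
    have : x ≠ n := by
      rintro rfl
      exact C.asymm hx hx
    omega⟩
  rwa [(B.bot hi).1 h] at hi

theorem IsBoundary.last_pos {e : ℕ → ℤˣ} {n : ℕ} {r : ℕ → ℕ → Prop} {w : List ℕ}
    (B : IsBoundary e (n + 1) r w) (C : IsCam e (n + 1) r) (he : e n = 1) :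
    w[w.length - 1]? = some n := by
  obtain ⟨i, hi⟩ := List.mem_iff_getElem?.1 ((B.exposed (by omega)).1 (exposed_ins_new C))
  have h : TopFree e r n := fun x hx => ⟨he, by
    have := (C.supp hx).2
    have : x ≠ n := by
      rintro rfl
      exact C.asymm hx hx
    omega⟩
  rwa [← (B.top hi).1 h, Nat.add_sub_cancel]

theorem IsBoundary.reach {e : ℕ → ℤˣ} {n : ℕ} {r : ℕ → ℕ → Prop} {w : List ℕ}
    (B : IsBoundary e n r w) {i j x y : ℕ} (hij : i ≤ j) (hx : w[i]? = some x)
    (hy : w[j]? = some y) : Relation.ReflTransGen r x y :=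
  reflTransGen_of_chain hij (fun _ _ _ _ _ => B.chain) hx hy

/-! ### Insertion in twin pairs -/

/-- The union of `r` with the reverse of `s`. -/
def twinRel (r s : ℕ → ℕ → Prop) (x y : ℕ) : Prop := r x y ∨ s y x

/-- The absence of directed cycles. -/
def Acyclic (r : ℕ → ℕ → Prop) : Prop := ∀ v, ¬ Relation.TransGen r v v

theorem acyclic_twinRel_comm {r s : ℕ → ℕ → Prop} (h : Acyclic (twinRel r s)) :
    Acyclic (twinRel s r) := by
  intro v hv
  refine h v ?_
  rw [← Relation.transGen_swap]
  exact Relation.TransGen.mono (fun x y hxy => Or.symm hxy) _ _ hv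

theorem SlotData.transGen_ins {r : ℕ → ℕ → Prop} {n : ℕ} {a b : Option ℕ} (S : SlotData r n a b)
    {x y : ℕ} (h : r x y) : Relation.TransGen (ins r n a b) x y := by
  by_cases h' : a = some x ∧ b = some y
  · exact (Relation.TransGen.single (S.ins_left.2 h'.1)).tail (S.ins_right.2 h'.2)
  · exact Relation.TransGen.single (Or.inl ⟨h, h'⟩)

theorem transGen_twinRel_left {r s : ℕ → ℕ → Prop} {x y : ℕ} (h : Relation.TransGen r x y) :
    Relation.TransGen (twinRel r s) x y :=
  Relation.TransGen.mono (fun _ _ => Or.inl) _ _ h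

theorem transGen_twinRel_right {r s : ℕ → ℕ → Prop} {x y : ℕ} (h : Relation.TransGen s y x) :
    Relation.TransGen (twinRel r s) x y := by
  rw [← Relation.transGen_swap]
  exact Relation.TransGen.mono (fun _ _ => Or.inr) _ _ h

theorem reflTransGen_twinRel_left {r s : ℕ → ℕ → Prop} {x y : ℕ}
    (h : Relation.ReflTransGen r x y) : Relation.ReflTransGen (twinRel r s) x y :=
  Relation.ReflTransGen.mono (fun _ _ => Or.inl) _ _ h

theorem reflTransGen_twinRel_right {r s : ℕ → ℕ → Prop} {x y : ℕ}
    (h : Relation.ReflTransGen s y x) : Relation.ReflTransGen (twinRel r s) x y := by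
  rw [← Relation.reflTransGen_swap]
  exact Relation.ReflTransGen.mono (fun _ _ => Or.inr) _ _ h

section

variable {e : ℕ → ℤˣ} {n : ℕ} {r s : ℕ → ℕ → Prop} {a b c d : Option ℕ}

theorem transGen_twinRel_ins (S : SlotData r n a b) (T : SlotData s n c d) {x y : ℕ}
    (h : twinRel r s x y) : Relation.TransGen (twinRel (ins r n a b) (ins s n c d)) x y :=
  h.elim (fun h => transGen_twinRel_left (S.transGen_ins h))
    fun h => transGen_twinRel_right (T.transGen_ins h)

/-- Insertion only subdivides old arcs, so a directed cycle would persist. -/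
theorem acyclic_of_acyclic_ins (S : SlotData r n a b) (T : SlotData s n c d)
    (h : Acyclic (twinRel (ins r n a b) (ins s n c d))) : Acyclic (twinRel r s) := by
  intro v hv
  refine h v ?_
  have key : ∀ x y, Relation.TransGen (twinRel r s) x y →
      Relation.TransGen (twinRel (ins r n a b) (ins s n c d)) x y := by
    intro x y hxy
    induction hxy with
    | single h => exact transGen_twinRel_ins S T h
    | tail _ h ih => exact ih.trans (transGen_twinRel_ins S T h)
  exact key v v hv

/-- By `hio`, each passage of a cycle through `n` can be replaced by an old directed path, which
would produce an old cycle. -/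
theorem acyclic_ins (S : SlotData r n a b) (T : SlotData s n c d) (h : Acyclic (twinRel r s))
    (hio : ∀ {x y}, a = some x ∨ d = some x → b = some y ∨ c = some y →
      Relation.TransGen (twinRel r s) x y) :
    Acyclic (twinRel (ins r n a b) (ins s n c d)) := by
  have hle : ∀ {x y}, twinRel (ins r n a b) (ins s n c d) x y → x < n + 1 ∧ y < n + 1 :=
    fun h => h.elim S.ins_supp fun h => (T.ins_supp h).symm
  have hin : ∀ {x}, twinRel (ins r n a b) (ins s n c d) x n → a = some x ∨ d = some x :=
    fun h => h.imp S.ins_left.1 T.ins_right.1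
  have hout : ∀ {x}, twinRel (ins r n a b) (ins s n c d) n x → b = some x ∨ c = some x :=
    fun h => h.imp S.ins_right.1 T.ins_left.1
  have hold : ∀ {x y}, x < n → y < n → twinRel (ins r n a b) (ins s n c d) x y →
      twinRel r s x y := fun hx hy h =>
    h.imp (fun h => ((SlotData.ins_lt hx hy).1 h).1) fun h => ((SlotData.ins_lt hy hx).1 h).1
  have key : ∀ {x y}, x < n →
      Relation.TransGen (twinRel (ins r n a b) (ins s n c d)) x y →
      (y < n → Relation.TransGen (twinRel r s) x y) ∧
        (y = n → ∃ p, (a = some p ∨ d = some p) ∧ Relation.ReflTransGen (twinRel r s) x p) := by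
    intro x y hx hxy
    induction hxy with
    | @single y h =>
      refine ⟨fun hy => Relation.TransGen.single (hold hx hy h), ?_⟩
      rintro rfl
      exact ⟨x, hin h, Relation.ReflTransGen.refl⟩
    | @tail y z _ h ih =>
      rcases Nat.lt_succ_iff_lt_or_eq.1 (hle h).1 with hy | hy
      · have ih := ih.1 hy
        refine ⟨fun hz => ih.tail (hold hy hz h), fun hz => ?_⟩
        rw [hz] at h
        exact ⟨y, hin h, ih.to_reflTransGen⟩
      · obtain ⟨p, hp, hxp⟩ := ih.2 hy
        rw [hy] at h
        have hz := hout h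
        have hzn : z < n := hz.elim S.hb T.ha
        exact ⟨fun _ => Relation.TransGen.trans_right hxp (hio hp hz), fun h => by omega⟩
  intro v hv
  have hvn : v < n + 1 := by
    obtain ⟨w, hw, _⟩ := Relation.TransGen.head'_iff.1 hv
    exact (hle hw).1
  rcases Nat.lt_succ_iff_lt_or_eq.1 hvn with hvn | rfl
  · exact h v ((key hvn hv).1 hvn)
  · obtain ⟨y, hy, hyv⟩ := Relation.TransGen.head'_iff.1 hv
    have hy' := hout hy
    have hyn : y < v := hy'.elim S.hb T.ha
    rcases Relation.reflTransGen_iff_eq_or_transGen.1 hyv with h' | h'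
    · omega
    · obtain ⟨p, hp, hyp⟩ := (key hyn h').2 rfl
      exact h p (Relation.TransGen.trans_left (hio hp hy') hyp)

end

section

variable {e : ℕ → ℤˣ} {n : ℕ} {r s : ℕ → ℕ → Prop} {w u : List ℕ}

theorem acyclic_ins_neg (B : IsBoundary e (n + 1) r w) (C : IsCam e (n + 1) r)
    (B' : IsBoundary e (n + 1) s u) (C' : IsCam e (n + 1) s) (he : e n = -1)
    (h : Acyclic (twinRel r s)) {i : ℕ} (hi : i < w.length) :
    Acyclic (twinRel (ins r (n + 1) (below w (i + 1)) w[i + 1]?)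
      (ins s (n + 1) (below u 0) u[0]?)) := by
  refine acyclic_ins (B.slotData C hi) (B'.slotData C' (by omega)) h ?_
  intro x y hx hy
  rcases hy with hy | hy
  · rcases hx with hx | hx
    · obtain ⟨j, hj, hx⟩ := below_eq_some.1 hx
      obtain rfl : i = j := by omega
      exact Relation.TransGen.single (Or.inl (B.chain hx hy))
    · rw [B'.last_neg C' he] at hx
      obtain rfl := Option.some.inj hx
      -- The newest old vertex `n` is the bottom of both boundaries, so `w` leads from it to the
      -- parent `w[i + 1]` of the inserted vertex.
      have hi' : w[i]? = some w[i] := List.getElem?_eq_getElem hi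
      exact transGen_twinRel_left (Relation.TransGen.tail'
        (B.reach (Nat.zero_le i) (B.last_neg C he) hi') (B.chain hi' hy))
  · simp [below] at hy

theorem acyclic_ins_pos (B : IsBoundary e (n + 1) r w) (C : IsCam e (n + 1) r)
    (B' : IsBoundary e (n + 1) s u) (C' : IsCam e (n + 1) s) (he : e n = 1)
    (h : Acyclic (twinRel r s)) {i : ℕ} (hi : i < w.length) :
    Acyclic (twinRel (ins r (n + 1) (below w i) w[i]?)
      (ins s (n + 1) (below u u.length) u[u.length]?)) := by
  refine acyclic_ins (B.slotData C hi.le) (B'.slotData C' le_rfl) h ?_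
  intro x y hx hy
  have hpos := B'.pos
  rcases hx with hx | hx
  · obtain ⟨j, rfl, hx⟩ := below_eq_some.1 hx
    rcases hy with hy | hy
    · exact Relation.TransGen.single (Or.inl (B.chain hx hy))
    · obtain ⟨k, hk, hy⟩ := below_eq_some.1 hy
      have hl := B'.last_pos C' he
      rw [hk, Nat.add_sub_cancel, hy] at hl
      obtain rfl := Option.some.inj hl
      have hi' : w[j + 1]? = some w[j + 1] := List.getElem?_eq_getElem hi
      exact transGen_twinRel_left (Relation.TransGen.head' (B.chain hx hi')
        (B.reach (by omega) hi' (B.last_pos C he)))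
  · simp at hx

/-- With both slots at the bottom, the new vertex and `n` form a 2-cycle. With neither there, a
cycle runs from the new vertex to `u[j]`, down `u` to the common bottom `n`, up `w` to `w[i]`, and
back. -/
theorem slot_of_acyclic_ins_neg (B : IsBoundary e (n + 1) r w) (C : IsCam e (n + 1) r)
    (B' : IsBoundary e (n + 1) s u) (C' : IsCam e (n + 1) s) (he : e n = -1) {i j : ℕ}
    (hi : i ≤ w.length) (hj : j ≤ u.length)
    (h : Acyclic (twinRel (ins r (n + 1) (below w i) w[i]?) (ins s (n + 1) (below u j) u[j]?))) :
    (i ≠ 0 ∧ j = 0) ∨ (i = 0 ∧ j ≠ 0) := by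
  have S := B.slotData C hi
  have T := B'.slotData C' hj
  rcases i with _ | i <;> rcases j with _ | j
  · exfalso
    refine h n ((Relation.TransGen.single ?_).tail (b := n + 1) ?_)
    · exact Or.inr (T.ins_right.2 (B'.last_neg C' he))
    · exact Or.inl (S.ins_right.2 (B.last_neg C he))
  · right; omega
  · left; omega
  · exfalso
    have hi' : w[i]? = some w[i] := List.getElem?_eq_getElem hi
    have hj' : u[j]? = some u[j] := List.getElem?_eq_getElem hj
    have h1 : twinRel (ins r (n + 1) (below w (i + 1)) w[i + 1]?)
        (ins s (n + 1) (below u (j + 1)) u[j + 1]?) w[i] (n + 1) :=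
      Or.inl (S.ins_left.2 (below_eq_some.2 ⟨i, rfl, hi'⟩))
    have h2 : twinRel (ins r (n + 1) (below w (i + 1)) w[i + 1]?)
        (ins s (n + 1) (below u (j + 1)) u[j + 1]?) (n + 1) u[j] :=
      Or.inr (T.ins_left.2 (below_eq_some.2 ⟨j, rfl, hj'⟩))
    have h3 : Relation.ReflTransGen (twinRel r s) u[j] w[i] :=
      (reflTransGen_twinRel_right (B'.reach (Nat.zero_le j) (B'.last_neg C' he) hj')).trans
        (reflTransGen_twinRel_left (B.reach (Nat.zero_le i) (B.last_neg C he) hi'))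
    have h4 := Relation.ReflTransGen.lift' (p := twinRel (ins r (n + 1) (below w (i + 1)) w[i + 1]?)
      (ins s (n + 1) (below u (j + 1)) u[j + 1]?)) id
      (fun x y hxy => (transGen_twinRel_ins S T hxy).to_reflTransGen) _ _ h3
    exact h (n + 1) (Relation.TransGen.tail' (Relation.ReflTransGen.head h2 h4) h1)

/-- The mirror image: two top slots give a 2-cycle with `n`. If neither is the top, a cycle climbs
`w` to the common top `n`, descends along `u`, and returns through `u[j]`. -/
theorem slot_of_acyclic_ins_pos (B : IsBoundary e (n + 1) r w) (C : IsCam e (n + 1) r)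
    (B' : IsBoundary e (n + 1) s u) (C' : IsCam e (n + 1) s) (he : e n = 1) {i j : ℕ}
    (hi : i ≤ w.length) (hj : j ≤ u.length)
    (h : Acyclic (twinRel (ins r (n + 1) (below w i) w[i]?) (ins s (n + 1) (below u j) u[j]?))) :
    (i < w.length ∧ j = u.length) ∨ (i = w.length ∧ j < u.length) := by
  have S := B.slotData C hi
  have T := B'.slotData C' hj
  have hw := B.pos
  have hu := B'.pos
  rcases hi.lt_or_eq with hi | rfl <;> rcases hj.lt_or_eq with hj | rfl
  · exfalso
    have hi' : w[i]? = some w[i] := List.getElem?_eq_getElem hi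
    have hj' : u[j]? = some u[j] := List.getElem?_eq_getElem hj
    have h1 : twinRel (ins r (n + 1) (below w i) w[i]?)
        (ins s (n + 1) (below u j) u[j]?) u[j] (n + 1) := Or.inr (T.ins_right.2 hj')
    have h2 : twinRel (ins r (n + 1) (below w i) w[i]?)
        (ins s (n + 1) (below u j) u[j]?) (n + 1) w[i] := Or.inl (S.ins_right.2 hi')
    have h3 : Relation.ReflTransGen (twinRel r s) w[i] u[j] :=
      (reflTransGen_twinRel_left (B.reach (by omega) hi' (B.last_pos C he))).trans
        (reflTransGen_twinRel_right (B'.reach (by omega) hj' (B'.last_pos C' he)))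
    have h4 := Relation.ReflTransGen.lift' (p := twinRel (ins r (n + 1) (below w i) w[i]?)
      (ins s (n + 1) (below u j) u[j]?)) id
      (fun x y hxy => (transGen_twinRel_ins S T hxy).to_reflTransGen) _ _ h3
    exact h (n + 1) (Relation.TransGen.tail' (Relation.ReflTransGen.head h2 h4) h1)
  · left; omega
  · right; omega
  · exfalso
    refine h n ((Relation.TransGen.single ?_).tail (b := n + 1) ?_)
    · exact Or.inl (S.ins_left.2 (below_eq_some.2 ⟨w.length - 1, by omega, B.last_pos C he⟩))
    · exact Or.inr (T.ins_left.2 (below_eq_some.2 ⟨u.length - 1, by omega, B'.last_pos C' he⟩))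

end

/-! ### Enumeration of twin pairs by the generating tree -/

/-- A pair of arc relations, each with its boundary. -/
abbrev TwinState : Type := (ℕ → ℕ → Prop) × List ℕ × (ℕ → ℕ → Prop) × List ℕ

/-- `t` consists of twin Cambrian trees on `n` vertices, with their boundaries. -/
structure IsTwinState (e : ℕ → ℤˣ) (n : ℕ) (t : TwinState) : Prop where
  cam₁ : IsCam e n t.1
  bdry₁ : IsBoundary e n t.1 t.2.1
  cam₂ : IsCam e n t.2.2.1
  bdry₂ : IsBoundary e n t.2.2.1 t.2.2.2
  acyclic : Acyclic (twinRel t.1 t.2.2.1)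

/-- Insertion of the vertex `n` in both trees, in the slots `p.1` and `p.2`. -/
def childState (e : ℕ → ℤˣ) (n : ℕ) (t : TwinState) (p : ℕ × ℕ) : TwinState :=
  (ins t.1 n (below t.2.1 p.1) t.2.1[p.1]?, nextBoundary e n t.2.1 p.1,
    ins t.2.2.1 n (below t.2.2.2 p.2) t.2.2.2[p.2]?, nextBoundary e n t.2.2.2 p.2)

/-- The pairs of slots which preserve twinness, when the last sign is `s` and the boundaries
have `k` and `l` vertices. -/
def twinSlots (s : ℤˣ) (k l : ℕ) : List (ℕ × ℕ) :=
  if s = -1 then (List.range k).map (fun i => (i + 1, 0)) ++ (List.range l).map fun j => (0, j + 1)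
  else (List.range k).map (fun i => (i, l)) ++ (List.range l).map fun j => (k, j)

/-- All twin states on `m + 1` vertices. -/
def twinStates (e : ℕ → ℤˣ) : ℕ → List TwinState
  | 0 => [(fun _ _ => False, [0], fun _ _ => False, [0])]
  | m + 1 => (twinStates e m).flatMap fun t =>
      (twinSlots (e m) t.2.1.length t.2.2.2.length).map (childState e (m + 1) t)

theorem mem_twinSlots_le {s : ℤˣ} {k l : ℕ} {p : ℕ × ℕ} (h : p ∈ twinSlots s k l) :
    p.1 ≤ k ∧ p.2 ≤ l := by
  unfold twinSlots at h
  split_ifs at h <;> simp only [List.mem_append, List.mem_map, List.mem_range] at h <;>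
    rcases h with ⟨i, hi, rfl⟩ | ⟨i, hi, rfl⟩ <;> dsimp only <;> omega

theorem nodup_twinSlots (s : ℤˣ) (k l : ℕ) : (twinSlots s k l).Nodup := by
  unfold twinSlots
  split_ifs
  · refine List.nodup_append.2 ⟨List.nodup_range.map fun i j h => ?_,
      List.nodup_range.map fun i j h => ?_, ?_⟩
    · simpa using h
    · simpa using h
    · intro x hx y hy
      simp only [List.mem_map, List.mem_range] at hx hy
      rcases hx with ⟨i, hi, rfl⟩
      rcases hy with ⟨j, hj, rfl⟩
      simp
  · refine List.nodup_append.2 ⟨List.nodup_range.map fun i j h => ?_,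
      List.nodup_range.map fun i j h => ?_, ?_⟩
    · simpa using h
    · simpa using h
    · intro x hx y hy
      simp only [List.mem_map, List.mem_range] at hx hy
      rcases hx with ⟨i, hi, rfl⟩
      rcases hy with ⟨j, hj, rfl⟩
      simp
      omega

theorem IsTwinState.acyclic_child_iff {e : ℕ → ℤˣ} {n : ℕ} {t : TwinState}
    (h : IsTwinState e (n + 1) t) {p : ℕ × ℕ} (h₁ : p.1 ≤ t.2.1.length)
    (h₂ : p.2 ≤ t.2.2.2.length) :
    Acyclic (twinRel (childState e (n + 1) t p).1 (childState e (n + 1) t p).2.2.1) ↔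
      p ∈ twinSlots (e n) t.2.1.length t.2.2.2.length := by
  obtain ⟨i, j⟩ := p
  have hac := acyclic_twinRel_comm h.acyclic
  unfold twinSlots childState
  dsimp only at h₁ h₂ ⊢
  split_ifs with he <;> simp only [List.mem_append, List.mem_map, List.mem_range, Prod.mk.injEq]
  · constructor
    · intro hh
      rcases slot_of_acyclic_ins_neg h.bdry₁ h.cam₁ h.bdry₂ h.cam₂ he h₁ h₂ hh with h' | h'
      · exact Or.inl ⟨i - 1, by omega, by omega, by omega⟩
      · exact Or.inr ⟨j - 1, by omega, by omega, by omega⟩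
    · rintro (⟨k, hk, rfl, rfl⟩ | ⟨k, hk, rfl, rfl⟩)
      · exact acyclic_ins_neg h.bdry₁ h.cam₁ h.bdry₂ h.cam₂ he h.acyclic hk
      · exact acyclic_twinRel_comm (acyclic_ins_neg h.bdry₂ h.cam₂ h.bdry₁ h.cam₁ he hac hk)
  · replace he := (Int.units_eq_one_or _).resolve_right he
    constructor
    · intro hh
      rcases slot_of_acyclic_ins_pos h.bdry₁ h.cam₁ h.bdry₂ h.cam₂ he h₁ h₂ hh with h' | h'
      · exact Or.inl ⟨i, by omega, by omega, by omega⟩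
      · exact Or.inr ⟨j, by omega, by omega, by omega⟩
    · rintro (⟨k, hk, rfl, rfl⟩ | ⟨k, hk, rfl, rfl⟩)
      · exact acyclic_ins_pos h.bdry₁ h.cam₁ h.bdry₂ h.cam₂ he h.acyclic hk
      · exact acyclic_twinRel_comm (acyclic_ins_pos h.bdry₂ h.cam₂ h.bdry₁ h.cam₁ he hac hk)

theorem mem_twinStates {e : ℕ → ℤˣ} (m : ℕ) {t : TwinState} :
    t ∈ twinStates e m ↔ IsTwinState e (m + 1) t := by
  induction m generalizing t with
  | zero =>
    rw [twinStates, List.mem_singleton]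
    constructor
    · rintro rfl
      have C : IsCam e 1 fun _ _ => False := isCam_one_iff.2 rfl
      refine ⟨C, isBoundary_one e, C, isBoundary_one e, fun v hv => ?_⟩
      obtain ⟨x, hx, _⟩ := Relation.TransGen.head'_iff.1 hv
      exact hx.elim id id
    · obtain ⟨r, w, s, u⟩ := t
      rintro ⟨C, B, C', B', _⟩
      dsimp only at C B C' B'
      obtain rfl := isCam_one_iff.1 C
      obtain rfl := isCam_one_iff.1 C'
      rw [B.unique (isBoundary_one e), B'.unique (isBoundary_one e)]
  | succ m ih =>
    rw [twinStates, List.mem_flatMap]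
    simp only [List.mem_map]
    constructor
    · rintro ⟨t₀, ht₀, p, hp, rfl⟩
      have h := ih.1 ht₀
      obtain ⟨h₁, h₂⟩ := mem_twinSlots_le hp
      exact ⟨h.bdry₁.isCam_ins h.cam₁ h₁, h.bdry₁.next h.cam₁ h₁, h.bdry₂.isCam_ins h.cam₂ h₂,
        h.bdry₂.next h.cam₂ h₂, (h.acyclic_child_iff h₁ h₂).2 hp⟩
    · intro h
      obtain ⟨r, w, i, C, B, hi, hr⟩ := h.cam₁.exists_ins (by omega) (IsCam.exists_boundary m)
      obtain ⟨s, u, j, C', B', hj, hs⟩ := h.cam₂.exists_ins (by omega) (IsCam.exists_boundary m)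
      have hac := h.acyclic
      rw [hr, hs] at hac
      have h₀ : IsTwinState e (m + 1) (r, w, s, u) :=
        ⟨C, B, C', B', acyclic_of_acyclic_ins (B.slotData C hi) (B'.slotData C' hj) hac⟩
      refine ⟨(r, w, s, u), ih.2 h₀, (i, j), (h₀.acyclic_child_iff hi hj).1 hac, ?_⟩
      obtain ⟨r', w', s', u'⟩ := t
      dsimp only at hr hs
      subst hr hs
      obtain rfl := h.bdry₁.unique (B.next C hi)
      obtain rfl := h.bdry₂.unique (B'.next C' hj)
      rfl

/-- Children of one node differ by their slots. Children of different nodes differ because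
contracting the new vertex recovers the parent node. -/
theorem nodup_twinStates (e : ℕ → ℤˣ) (m : ℕ) : (twinStates e m).Nodup := by
  induction m with
  | zero => simp [twinStates]
  | succ m ih =>
    rw [twinStates, List.nodup_flatMap]
    refine ⟨fun t ht => ?_, ?_⟩
    · have h := (mem_twinStates m).1 ht
      refine List.Nodup.map_on (fun p hp q hq hpq => ?_) (nodup_twinSlots _ _ _)
      obtain ⟨h₁, h₂⟩ := mem_twinSlots_le hp
      obtain ⟨h₁', h₂'⟩ := mem_twinSlots_le hq
      exact Prod.ext (h.bdry₁.slot_inj h.cam₁ h₁ h₁' (congrArg (fun t => t.1) hpq))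
        (h.bdry₂.slot_inj h.cam₂ h₂ h₂' (congrArg (fun t => t.2.2.1) hpq))
    · refine (List.nodup_iff_pairwise_ne.1 ih).imp_of_mem fun {t t'} ht ht' hne => ?_
      have h := (mem_twinStates m).1 ht
      have h' := (mem_twinStates m).1 ht'
      intro x hx hx'
      simp only [List.mem_map] at hx hx'
      obtain ⟨p, hp, rfl⟩ := hx
      obtain ⟨q, hq, hqp⟩ := hx'
      obtain ⟨h₁, h₂⟩ := mem_twinSlots_le hp
      obtain ⟨h₁', h₂'⟩ := mem_twinSlots_le hq
      have e₁ : t'.1 = t.1 := by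
        rw [← con_ins (h'.bdry₁.slotData h'.cam₁ h₁'), ← con_ins (h.bdry₁.slotData h.cam₁ h₁)]
        exact congrArg (fun t => con t.1 (m + 1)) hqp
      have e₂ : t'.2.2.1 = t.2.2.1 := by
        rw [← con_ins (h'.bdry₂.slotData h'.cam₂ h₂'), ← con_ins (h.bdry₂.slotData h.cam₂ h₂)]
        exact congrArg (fun t => con t.2.2.1 (m + 1)) hqp
      have e₃ : t'.2.1 = t.2.1 := (e₁ ▸ h'.bdry₁).unique h.bdry₁
      have e₄ : t'.2.2.2 = t.2.2.2 := (e₂ ▸ h'.bdry₂).unique h.bdry₂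
      exact hne (Prod.ext e₁.symm (Prod.ext e₃.symm (Prod.ext e₂.symm e₄.symm)))

theorem length_nextBoundary (e : ℕ → ℤˣ) (n : ℕ) {w : List ℕ} {i : ℕ} (hi : i ≤ w.length) :
    (nextBoundary e n w i).length - 1 = if e n = -1 then w.length - i else i := by
  unfold nextBoundary
  split_ifs
  · simp
  · simp [hi]

theorem sum_range_sub_succ (f : ℕ → ℕ) (k : ℕ) :
    ∑ i ∈ Finset.range (k + 1), f (k + 1 - i) = ∑ i ∈ Finset.range (k + 1), f (i + 1) := by
  rw [← Finset.sum_range_reflect]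
  refine Finset.sum_congr rfl fun i hi => ?_
  rw [Finset.mem_range] at hi
  congr 1; omega

theorem sum_range_sub (f : ℕ → ℕ) (k : ℕ) :
    ∑ i ∈ Finset.range (k + 1), f (k - i) = ∑ i ∈ Finset.range (k + 1), f i := by
  rw [← Finset.sum_range_reflect]
  refine Finset.sum_congr rfl fun i hi => ?_
  rw [Finset.mem_range] at hi
  congr 1; omega

theorem sum_childState (e : ℕ → ℤˣ) (m : ℕ) (t : TwinState) (f : ℕ → ℕ → ℕ)
    (h₁ : 0 < t.2.1.length) (h₂ : 0 < t.2.2.2.length) :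
    (((twinSlots (e m) t.2.1.length t.2.2.2.length).map (childState e (m + 1) t)).map
      fun t => f (t.2.1.length - 1) (t.2.2.2.length - 1)).sum =
      stepOp (decide (e m ≠ e (m + 1))) f (t.2.1.length - 1) (t.2.2.2.length - 1) := by
  obtain ⟨r, w, s, u⟩ := t
  dsimp only at h₁ h₂ ⊢
  rw [List.map_map]
  have hc : (twinSlots (e m) w.length u.length).map
      ((fun t : TwinState => f (t.2.1.length - 1) (t.2.2.2.length - 1)) ∘
        childState e (m + 1) (r, w, s, u)) =
      (twinSlots (e m) w.length u.length).map fun p =>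
        f (if e (m + 1) = -1 then w.length - p.1 else p.1)
          (if e (m + 1) = -1 then u.length - p.2 else p.2) := by
    refine List.map_congr_left fun p hp => ?_
    obtain ⟨h₁, h₂⟩ := mem_twinSlots_le hp
    simp only [Function.comp, childState, length_nextBoundary e (m + 1) h₁,
      length_nextBoundary e (m + 1) h₂]
  rw [hc]
  obtain ⟨k, hk⟩ : ∃ k, w.length = k + 1 := ⟨w.length - 1, by omega⟩
  obtain ⟨l, hl⟩ : ∃ l, u.length = l + 1 := ⟨u.length - 1, by omega⟩
  have hr : ∀ (g : ℕ → ℕ) (k : ℕ), ((List.range k).map g).sum = ∑ i ∈ Finset.range k, g i :=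
    fun g k => rfl
  rw [hk, hl]
  have hne := units_one_ne_neg_one
  rcases Int.units_eq_one_or (e m) with h | h <;>
    rcases Int.units_eq_one_or (e (m + 1)) with h' | h' <;>
    simp only [twinSlots, h, h', hne, hne.symm, if_true, if_false, List.map_append, List.map_map,
      List.sum_append, Function.comp_def, hr, stepOp, ne_eq, not_true_eq_false, not_false_eq_true,
      decide_true, decide_false, Bool.false_eq_true, sameOp, switchOp, Nat.add_sub_cancel,
      Nat.sub_self, Nat.sub_zero, Nat.add_sub_add_right]
  -- A new negative vertex keeps what lies above the slot, so here and in the next case the labels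
  -- decrease as the slot rises and the sum is reversed.
  · rw [sum_range_sub_succ (fun i => f i 0), sum_range_sub_succ (fun i => f 0 i)]
  · rw [sum_range_sub (fun i => f i (l + 1)), sum_range_sub (fun i => f (k + 1) i)]

/-- A general test function `f` lets the induction remove the last insertion: summing `f` over the
children of a node applies one operator to `f` at its label. -/
theorem sum_twinStates (e : ℕ → ℤˣ) (m : ℕ) (f : ℕ → ℕ → ℕ) :
    ((twinStates e m).map fun t => f (t.2.1.length - 1) (t.2.2.2.length - 1)).sum =
      growth (fun i => decide (e i ≠ e (i + 1))) m f 0 0 := by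
  induction m generalizing f with
  | zero => simp [twinStates, growth]
  | succ m ih =>
    rw [growth, ← ih, twinStates, List.flatMap_def, List.map_flatten, List.sum_flatten,
      List.map_map, List.map_map]
    congr 1
    refine List.map_congr_left fun t ht => ?_
    have h := (mem_twinStates m).1 ht
    exact sum_childState e m t f h.bdry₁.pos h.bdry₂.pos

theorem length_twinStates (e : ℕ → ℤˣ) (m : ℕ) :
    (twinStates e m).length = growth (fun i => decide (e i ≠ e (i + 1))) m (fun _ _ => 1) 0 0 := by
  rw [← sum_twinStates]
  simp

/-- The trees determine their boundaries, so forgetting the latter keeps the list free of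
repetitions. -/
theorem card_twin (e : ℕ → ℤˣ) (m : ℕ) :
    Nat.card {p : (ℕ → ℕ → Prop) × (ℕ → ℕ → Prop) //
      IsCam e (m + 1) p.1 ∧ IsCam e (m + 1) p.2 ∧ Acyclic (twinRel p.1 p.2)} =
      growth (fun i => decide (e i ≠ e (i + 1))) m (fun _ _ => 1) 0 0 := by
  classical
  rw [← length_twinStates]
  set L := (twinStates e m).map fun t => (t.1, t.2.2.1) with hL
  have hnd : L.Nodup := by
    refine List.Nodup.map_on (fun t ht t' ht' htt => ?_) (nodup_twinStates e m)
    have h := (mem_twinStates m).1 ht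
    have h' := (mem_twinStates m).1 ht'
    have e₁ : t.1 = t'.1 := (Prod.mk.inj htt).1
    have e₂ : t.2.2.1 = t'.2.2.1 := (Prod.mk.inj htt).2
    exact Prod.ext e₁ (Prod.ext ((e₁ ▸ h.bdry₁).unique h'.bdry₁)
      (Prod.ext e₂ ((e₂ ▸ h.bdry₂).unique h'.bdry₂)))
  have hmem : ∀ p, p ∈ L ↔
      IsCam e (m + 1) p.1 ∧ IsCam e (m + 1) p.2 ∧ Acyclic (twinRel p.1 p.2) := by
    intro p
    rw [hL, List.mem_map]
    constructor
    · rintro ⟨t, ht, rfl⟩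
      have h := (mem_twinStates m).1 ht
      exact ⟨h.cam₁, h.cam₂, h.acyclic⟩
    · rintro ⟨h₁, h₂, h⟩
      obtain ⟨w, B⟩ := IsCam.exists_boundary m h₁
      obtain ⟨u, B'⟩ := IsCam.exists_boundary m h₂
      exact ⟨(p.1, w, p.2, u), (mem_twinStates m).2 ⟨h₁, B, h₂, B', h⟩, rfl⟩
  rw [Nat.card_congr (Equiv.subtypeEquivRight fun p => ((hmem p).symm.trans
    List.mem_toFinset.symm)), Nat.card_eq_fintype_card, Fintype.card_coe,
    List.toFinset_card_of_nodup hnd, hL, List.length_map]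

/-! ### Translation between labelled trees and relations on natural numbers -/

section

variable {n : ℕ}

/-- A signature as a sequence of signs. -/
def Signature.extend (ε : Signature n) (i : ℕ) : ℤˣ := if h : i < n then ε ⟨i, h⟩ else 1

theorem Signature.extend_coe (ε : Signature n) (v : Fin n) : ε.extend v = ε v := by
  simp [Signature.extend]

/-- A relation on `Fin n` as a relation on natural numbers. -/
def natRel (arc : Fin n → Fin n → Prop) (x y : ℕ) : Prop :=
  ∃ (hx : x < n) (hy : y < n), arc ⟨x, hx⟩ ⟨y, hy⟩

theorem natRel_coe {arc : Fin n → Fin n → Prop} {v w : Fin n} : natRel arc v w ↔ arc v w := by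
  simp [natRel]

/-- For `c = v` the two sides differ: no walk from `v` avoids `v`, whereas `Linked` is reflexive. -/
theorem mem_attachedSubtree_iff {arc : Fin n → Fin n → Prop} {v c u : Fin n} (hcv : c ≠ v) :
    u ∈ attachedSubtree (SimpleGraph.fromRel arc) v c ↔ Linked (natRel arc) v c u := by
  constructor
  · rintro ⟨p, hp⟩
    induction p with
    | nil => exact Relation.ReflTransGen.refl
    | @cons a b d h p ih =>
      rw [SimpleGraph.Walk.support_cons, List.mem_cons, not_or] at hp
      have hbv : b ≠ v := by
        rintro rfl
        exact hp.2 p.start_mem_support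
      refine Relation.ReflTransGen.head ⟨?_, ?_, ?_⟩ (ih hbv hp.2)
      · rw [SimpleGraph.fromRel_adj] at h
        exact h.2.imp natRel_coe.2 natRel_coe.2
      · exact fun h => hcv (Fin.ext h)
      · exact fun h => hbv (Fin.ext h)
  · intro h
    have key : ∀ x : ℕ, Linked (natRel arc) v c x →
        ∃ hx : x < n, (⟨x, hx⟩ : Fin n) ∈ attachedSubtree (SimpleGraph.fromRel arc) v c := by
      intro x hx
      induction hx with
      | refl =>
        refine ⟨c.2, SimpleGraph.Walk.nil, ?_⟩
        simpa using hcv.symm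
      | @tail x y _ hxy ih =>
        obtain ⟨hx, p, hp⟩ := ih
        obtain ⟨hxy, hxv, hyv⟩ := hxy
        have hy : y < n := by
          rcases hxy with ⟨h1, h2, _⟩ | ⟨h1, h2, _⟩
          · exact h2
          · exact h1
        by_cases hxy' : x = y
        · subst hxy'
          exact ⟨hx, p, hp⟩
        have hadj : (SimpleGraph.fromRel arc).Adj ⟨x, hx⟩ ⟨y, hy⟩ := by
          rw [SimpleGraph.fromRel_adj]
          refine ⟨fun h => hxy' (congrArg Fin.val h), ?_⟩
          rcases hxy with ⟨_, _, h⟩ | ⟨_, _, h⟩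
          · exact Or.inl h
          · exact Or.inr h
        refine ⟨hy, p.concat hadj, ?_⟩
        rw [SimpleGraph.Walk.support_concat, List.mem_append, not_or]
        refine ⟨hp, ?_⟩
        rw [List.mem_singleton]
        rintro rfl
        exact hyv rfl
    exact (key u h).2

theorem linked_of_reachable {arc : Fin n → Fin n → Prop} {v : ℕ} (hv : n ≤ v) {x y : Fin n}
    (h : (SimpleGraph.fromRel arc).Reachable x y) : Linked (natRel arc) v x y := by
  obtain ⟨p⟩ := h
  induction p with
  | nil => exact Relation.ReflTransGen.refl
  | @cons a b d h p ih =>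
    refine Relation.ReflTransGen.head ⟨?_, by omega, by omega⟩ ih
    rw [SimpleGraph.fromRel_adj] at h
    exact h.2.imp natRel_coe.2 natRel_coe.2

theorem reachable_of_linked {arc : Fin n → Fin n → Prop} {v : ℕ} {x y : Fin n}
    (h : Linked (natRel arc) v x y) : (SimpleGraph.fromRel arc).Reachable x y := by
  have key : ∀ z : ℕ, Linked (natRel arc) v x z →
      ∃ hz : z < n, (SimpleGraph.fromRel arc).Reachable x ⟨z, hz⟩ := by
    intro z hz
    induction hz with
    | refl => exact ⟨x.2, SimpleGraph.Reachable.refl _⟩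
    | @tail z w _ hzw ih =>
      obtain ⟨hz, hr⟩ := ih
      have hw : w < n := by
        rcases hzw.1 with ⟨h1, h2, _⟩ | ⟨h1, h2, _⟩
        · exact h2
        · exact h1
      refine ⟨hw, ?_⟩
      by_cases hne : z = w
      · subst hne; exact hr
      refine hr.trans (SimpleGraph.Adj.reachable ?_)
      rw [SimpleGraph.fromRel_adj]
      refine ⟨fun h => hne (congrArg Fin.val h), ?_⟩
      rcases hzw.1 with ⟨_, _, h⟩ | ⟨_, _, h⟩
      · exact Or.inl h
      · exact Or.inr h
  exact (key y h).2

/-- The edge `vc` is a bridge, so it lies on the walk from `v` through `c'` to `c`. That walk does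
not revisit `v`, so its first edge is `vc`. -/
theorem eq_of_isAcyclic {V : Type*} {G : SimpleGraph V} (hG : G.IsAcyclic) {v c c' : V}
    (hc : G.Adj v c) (hc' : G.Adj v c') (h : c' ∈ attachedSubtree G v c) : c = c' := by
  by_contra hne
  obtain ⟨p, hp⟩ := h
  have hb := SimpleGraph.isBridge_iff_forall_walk_mem_edges.1
    (SimpleGraph.isAcyclic_iff_forall_adj_isBridge.1 hG hc) (SimpleGraph.Walk.cons hc' p.reverse)
  rw [SimpleGraph.Walk.edges_cons, List.mem_cons] at hb
  rcases hb with hb | hb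
  · rw [Sym2.eq_iff] at hb
    rcases hb with ⟨_, h⟩ | ⟨h, _⟩
    · exact hne h
    · exact hc'.ne h
  · have := p.reverse.fst_mem_support_of_mem_edges hb
    rw [SimpleGraph.Walk.support_reverse, List.mem_reverse] at this
    exact hp this

/-- Every edge is a bridge, since `not_reachable_of_acyc` forbids reconnecting its ends by the other
edges. -/
theorem isAcyclic_of_acyc {arc : Fin n → Fin n → Prop}
    (hasymm : ∀ {x y}, natRel arc x y → ¬ natRel arc y x)
    (hac : ∀ {v c c'}, natRel arc v c ∨ natRel arc c v → natRel arc v c' ∨ natRel arc c' v →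
      Linked (natRel arc) v c c' → c = c') : (SimpleGraph.fromRel arc).IsAcyclic := by
  rw [SimpleGraph.isAcyclic_iff_forall_adj_isBridge]
  have key : ∀ {v w : Fin n}, arc v w → (SimpleGraph.fromRel arc).IsBridge s(v, w) := by
    intro v w hvw
    rw [SimpleGraph.isBridge_iff]
    rintro ⟨p⟩
    refine not_reachable_of_acyc (r := natRel arc) hasymm hac (natRel_coe.2 hvw) ?_
    have aux : ∀ {x y : Fin n}, ((SimpleGraph.fromRel arc).deleteEdges {s(v, w)}).Walk x y →
        Relation.ReflTransGen (fun z z' : ℕ =>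
          (natRel arc z z' ∧ ¬ (z = (v : ℕ) ∧ z' = (w : ℕ))) ∨
            (natRel arc z' z ∧ ¬ (z' = (v : ℕ) ∧ z = (w : ℕ)))) x y := by
      intro x y p
      induction p with
      | nil => exact Relation.ReflTransGen.refl
      | @cons a b d h p ih =>
        refine Relation.ReflTransGen.head ?_ ih
        rw [SimpleGraph.deleteEdges_adj, SimpleGraph.fromRel_adj, Set.mem_singleton_iff,
          Sym2.eq_iff, not_or] at h
        obtain ⟨⟨_, h⟩, h1, h2⟩ := h
        simp only [Fin.val_inj, natRel_coe]
        tauto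
    exact aux p
  intro v w hvw
  rw [SimpleGraph.fromRel_adj] at hvw
  rcases hvw.2 with h | h
  · exact key h
  · rw [Sym2.eq_swap]
    exact key h

theorem CambrianTree.isCam {ε : Signature n} (T : CambrianTree ε) :
    IsCam ε.extend n (natRel T.arc) := by
  have hirr : ∀ {v}, ¬ T.arc v v := fun h => T.asymm _ _ h h
  have hadj : ∀ {v c : Fin n}, T.arc v c ∨ T.arc c v → (SimpleGraph.fromRel T.arc).Adj v c := by
    intro v c h
    rw [SimpleGraph.fromRel_adj]
    refine ⟨?_, h⟩
    rintro rfl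
    exact h.elim hirr hirr
  have hnat : ∀ {x y}, natRel T.arc x y → x < n ∧ y < n := fun ⟨hx, hy, _⟩ => ⟨hx, hy⟩
  have hside : ∀ {v c : Fin n}, T.arc v c ∨ T.arc c v →
      ((∀ u ∈ attachedSubtree (SimpleGraph.fromRel T.arc) v c, u < v) ∨
        (∀ u ∈ attachedSubtree (SimpleGraph.fromRel T.arc) v c, v < u)) →
      (∀ u, Linked (natRel T.arc) v c u → u < v) ∨ ∀ u, Linked (natRel T.arc) v c u → (v : ℕ) < u := by
    intro v c hc h
    have hcv : c ≠ v := (hadj hc).ne'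
    have hlt : ∀ {u}, Linked (natRel T.arc) v c u → u < n := fun hu =>
      Linked.lt (fun h => hnat h) hu c.2
    exact h.imp (fun h u hu => h ⟨u, hlt hu⟩ ((mem_attachedSubtree_iff hcv).2 hu))
      fun h u hu => h ⟨u, hlt hu⟩ ((mem_attachedSubtree_iff hcv).2 hu)
  refine ⟨hnat, ?_, ?_, ?_, ?_, ?_, ?_⟩
  · rintro x y ⟨hx, hy, h⟩ ⟨_, _, h'⟩
    exact T.asymm _ _ h h'
  · intro v x y hv hx hy
    exact linked_of_reachable (x := ⟨x, hx⟩) (y := ⟨y, hy⟩) hv (T.isTree.connected.preconnected _ _)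
  · intro v c c' hc hc' hl
    have hv : v < n := hc.elim (fun h => (hnat h).1) fun h => (hnat h).2
    have hcn : c < n := hc.elim (fun h => (hnat h).2) fun h => (hnat h).1
    have hcn' : c' < n := hc'.elim (fun h => (hnat h).2) fun h => (hnat h).1
    lift v to Fin n using hv
    lift c to Fin n using hcn
    lift c' to Fin n using hcn'
    simp only [natRel_coe] at hc hc'
    exact congrArg Fin.val (eq_of_isAcyclic T.isTree.isAcyclic (hadj hc) (hadj hc')
      ((mem_attachedSubtree_iff (hadj hc).ne').2 hl))
  · intro v c c' hc hc'
    have hv : v < n := hc.nbr.elim (fun h => (hnat h).1) fun h => (hnat h).2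
    have hcn : c < n := hc.nbr.elim (fun h => (hnat h).2) fun h => (hnat h).1
    have hcn' : c' < n := hc'.nbr.elim (fun h => (hnat h).2) fun h => (hnat h).1
    lift v to Fin n using hv
    lift c to Fin n using hcn
    lift c' to Fin n using hcn'
    simp only [Sgl, natRel_coe, Signature.extend_coe] at hc hc'
    have h1 := T.neg_parent v
    have h2 := T.pos_child v
    have hne := units_one_ne_neg_one
    grind
  · intro v c hc
    have hv : v < n := hc.nbr.elim (fun h => (hnat h).1) fun h => (hnat h).2
    have hcn : c < n := hc.nbr.elim (fun h => (hnat h).2) fun h => (hnat h).1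
    lift v to Fin n using hv
    lift c to Fin n using hcn
    simp only [Dbl, natRel_coe, Signature.extend_coe] at hc
    rcases hc with ⟨he, hc⟩ | ⟨he, hc⟩
    · exact hside (Or.inr hc) (T.neg_side v he c hc)
    · exact hside (Or.inl hc) (T.pos_side v he c hc)
  · intro v c c' hc hc' hs
    have hv : v < n := hc.nbr.elim (fun h => (hnat h).1) fun h => (hnat h).2
    have hcn : c < n := hc.nbr.elim (fun h => (hnat h).2) fun h => (hnat h).1
    have hcn' : c' < n := hc'.nbr.elim (fun h => (hnat h).2) fun h => (hnat h).1
    lift v to Fin n using hv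
    lift c to Fin n using hcn
    lift c' to Fin n using hcn'
    simp only [Dbl, natRel_coe, Signature.extend_coe] at hc hc'
    have h1 := T.neg_child v
    have h2 := T.pos_parent v
    have hne := units_one_ne_neg_one
    simp only [Fin.val_fin_lt] at hs
    grind

theorem CambrianTree.exists_of_isCam {ε : Signature n} (hn : 1 ≤ n) {r : ℕ → ℕ → Prop}
    (C : IsCam ε.extend n r) : ∃ T : CambrianTree ε, natRel T.arc = r := by
  set arc : Fin n → Fin n → Prop := fun v w => r v w with harc
  have hr : natRel arc = r := by
    funext x y
    exact propext ⟨fun ⟨_, _, h⟩ => h, fun h => ⟨(C.supp h).1, (C.supp h).2, h⟩⟩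
  have hne : ∀ {v c : Fin n}, arc v c ∨ arc c v → c ≠ v := by
    rintro v c h rfl
    exact h.elim (fun h => C.asymm h h) fun h => C.asymm h h
  have hside : ∀ {v c : Fin n}, Dbl ε.extend r v c → arc v c ∨ arc c v →
      (∀ u ∈ attachedSubtree (SimpleGraph.fromRel arc) v c, u < v) ∨
        (∀ u ∈ attachedSubtree (SimpleGraph.fromRel arc) v c, v < u) := by
    intro v c hd hc
    refine (C.side hd).imp (fun h u hu => ?_) fun h u hu => ?_ <;>
      rw [mem_attachedSubtree_iff (hne hc), hr] at hu <;> exact h u hu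
  -- Connectedness includes having a vertex.
  have : Nonempty (Fin n) := ⟨⟨0, hn⟩⟩
  have he : ∀ {v : Fin n} {s : ℤˣ}, ε v = s → ε.extend v = s := fun h =>
    (ε.extend_coe _).trans h
  refine ⟨⟨arc, fun v w => C.asymm, ⟨⟨fun x y => ?_⟩, ?_⟩, ?_, ?_, ?_, ?_, ?_, ?_⟩, hr⟩
  · exact reachable_of_linked (v := n) (by rw [hr]; exact C.conn le_rfl x.2 y.2)
  · refine isAcyclic_of_acyc ?_ ?_ <;> rw [hr]
    · exact C.asymm
    · exact C.acyc
  · intro v hv w w' h h'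
    exact Fin.ext (C.sgl (Or.inl ⟨he hv, h⟩) (Or.inl ⟨he hv, h'⟩))
  · intro v hv c hc
    exact hside (Or.inl ⟨he hv, hc⟩) (Or.inr hc)
  · intro v hv w w' h h' hs
    exact Fin.ext (C.dbl (Or.inl ⟨he hv, h⟩) (Or.inl ⟨he hv, h'⟩) hs)
  · intro v hv w w' h h'
    exact Fin.ext (C.sgl (Or.inr ⟨he hv, h⟩) (Or.inr ⟨he hv, h'⟩))
  · intro v hv c hc
    exact hside (Or.inr ⟨he hv, hc⟩) (Or.inl hc)
  · intro v hv w w' h h' hs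
    exact Fin.ext (C.dbl (Or.inr ⟨he hv, h⟩) (Or.inr ⟨he hv, h'⟩) hs)

theorem areTwin_iff {ε : Signature n} (S T : CambrianTree ε) :
    AreTwin S T ↔ Acyclic (twinRel (natRel S.arc) (natRel T.arc)) := by
  constructor
  · intro h v hv
    have key : ∀ {x y : ℕ}, Relation.TransGen (twinRel (natRel S.arc) (natRel T.arc)) x y →
        ∃ (hx : x < n) (hy : y < n),
          Relation.TransGen (fun u w => S.arc u w ∨ T.arc w u) ⟨x, hx⟩ ⟨y, hy⟩ := by
      have h1 : ∀ {x y : ℕ}, twinRel (natRel S.arc) (natRel T.arc) x y →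
          ∃ (hx : x < n) (hy : y < n), S.arc ⟨x, hx⟩ ⟨y, hy⟩ ∨ T.arc ⟨y, hy⟩ ⟨x, hx⟩ := by
        rintro x y (⟨hx, hy, h⟩ | ⟨hy, hx, h⟩)
        · exact ⟨hx, hy, Or.inl h⟩
        · exact ⟨hx, hy, Or.inr h⟩
      intro x y hxy
      induction hxy with
      | single h =>
        obtain ⟨hx, hy, h⟩ := h1 h
        exact ⟨hx, hy, Relation.TransGen.single h⟩
      | tail _ h ih =>
        obtain ⟨hx, _, ih⟩ := ih
        obtain ⟨_, hy, h⟩ := h1 h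
        exact ⟨hx, hy, ih.tail h⟩
    obtain ⟨hx, _, hv⟩ := key hv
    exact h _ hv
  · intro h v hv
    refine h v (Relation.TransGen.lift Fin.val (fun x y hxy => ?_) _ _ hv)
    exact hxy.imp natRel_coe.2 natRel_coe.2

theorem natRel_injective {ε : Signature n} {S T : CambrianTree ε}
    (h : natRel S.arc = natRel T.arc) : S = T := by
  refine CambrianTree.ext ?_
  funext v w
  rw [← natRel_coe (arc := S.arc), ← natRel_coe (arc := T.arc), h]

end

/-! ### The Baxter-Cambrian numbers and their comparison -/

theorem baxterCambrianNumber_eq {m : ℕ} (ε : Signature (m + 1)) :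
    baxterCambrianNumber ε =
      growth (fun i => decide (ε.extend i ≠ ε.extend (i + 1))) m (fun _ _ => 1) 0 0 := by
  rw [← card_twin, baxterCambrianNumber]
  refine Nat.card_congr (Equiv.ofBijective (fun P => ⟨(natRel P.1.1.arc, natRel P.1.2.arc),
    P.1.1.isCam, P.1.2.isCam, (areTwin_iff _ _).1 P.2⟩) ⟨?_, ?_⟩)
  · rintro ⟨⟨S, T⟩, h⟩ ⟨⟨S', T'⟩, h'⟩ hh
    simp only [Subtype.mk.injEq, Prod.mk.injEq] at hh
    obtain rfl := natRel_injective hh.1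
    obtain rfl := natRel_injective hh.2
    rfl
  · rintro ⟨⟨r, s⟩, C, C', h⟩
    obtain ⟨S, rfl⟩ := CambrianTree.exists_of_isCam (by omega) C
    obtain ⟨T, rfl⟩ := CambrianTree.exists_of_isCam (by omega) C'
    exact ⟨⟨(S, T), (areTwin_iff _ _).2 h⟩, rfl⟩

theorem mem_switchGaps_iff {m : ℕ} {ε : Signature (m + 1)} {i : ℕ} :
    i + 1 ∈ switchGaps ε ↔ i < m ∧ ε.extend i ≠ ε.extend (i + 1) := by
  constructor
  · rintro ⟨_, h, hne⟩
    refine ⟨by omega, ?_⟩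
    simpa [Signature.extend, h, show i < m + 1 by omega] using hne
  · rintro ⟨h, hne⟩
    refine ⟨by omega, by omega, ?_⟩
    simpa [Signature.extend, h, show i < m + 1 by omega] using hne

theorem extend_alternatingSignature_ne {m i : ℕ} (hi : i < m) :
    (alternatingSignature (m + 1)).extend i ≠ (alternatingSignature (m + 1)).extend (i + 1) := by
  simp only [Signature.extend, alternatingSignature, show i < m + 1 by omega,
    show i + 1 < m + 1 by omega, dif_pos, pow_succ]
  rcases neg_one_pow_eq_or ℤˣ i with h | h <;> rw [h] <;> decide

theorem extend_constantSignature {m : ℕ} (i : ℕ) : (constantSignature (m + 1)).extend i = 1 := by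
  simp [Signature.extend, constantSignature]

theorem decide_ne_le_of_switchGaps {m : ℕ} {ε ε' : Signature (m + 1)}
    (h : switchGaps ε ⊆ switchGaps ε') (i : ℕ) (hi : i < m) :
    decide (ε.extend i ≠ ε.extend (i + 1)) ≤ decide (ε'.extend i ≠ ε'.extend (i + 1)) := by
  by_cases h1 : ε.extend i ≠ ε.extend (i + 1)
  · have := (mem_switchGaps_iff.1 (h (mem_switchGaps_iff.2 ⟨hi, h1⟩))).2
    simp [h1, this]
  · rw [decide_eq_false h1]
    exact Bool.false_le _

theorem baxterCambrianNumber_anti {m : ℕ} {ε ε' : Signature (m + 1)}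
    (h : switchGaps ε ⊆ switchGaps ε') : baxterCambrianNumber ε' ≤ baxterCambrianNumber ε := by
  rw [baxterCambrianNumber_eq, baxterCambrianNumber_eq]
  exact growth_one_anti m (decide_ne_le_of_switchGaps h)

theorem mainTheorem10 (n : ℕ) (hn : 1 ≤ n) :
    (∀ ε : Signature n,
      baxterCambrianNumber (alternatingSignature n) ≤ baxterCambrianNumber ε ∧
        baxterCambrianNumber ε ≤ baxterCambrianNumber (constantSignature n)) ∧
    baxterCambrianNumber (alternatingSignature n) = (2 * n - 2).choose (n - 1) ∧
    (baxterCambrianNumber (constantSignature n) : ℚ) =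
      ((n + 1).choose 1 : ℚ)⁻¹ * ((n + 1).choose 2 : ℚ)⁻¹ *
        ∑ k ∈ Finset.Icc 1 n,
          ((n + 1).choose (k - 1) : ℚ) * ((n + 1).choose k : ℚ) * ((n + 1).choose (k + 1) : ℚ) ∧
    (∀ ε ε' : Signature n, switchGaps ε ⊆ switchGaps ε' →
      baxterCambrianNumber ε' ≤ baxterCambrianNumber ε ∧
        ((∃ g ∈ switchGaps ε' \ switchGaps ε, 2 ≤ g ∧ g + 2 ≤ n) →
          baxterCambrianNumber ε' < baxterCambrianNumber ε)) := by
  obtain ⟨m, rfl⟩ : ∃ m, n = m + 1 := ⟨n - 1, by omega⟩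
  refine ⟨fun ε => ⟨baxterCambrianNumber_anti ?_, baxterCambrianNumber_anti ?_⟩, ?_, ?_,
    fun ε ε' h => ⟨baxterCambrianNumber_anti h, ?_⟩⟩
  · intro g hg
    obtain ⟨i, rfl⟩ : ∃ i, g = i + 1 := ⟨g - 1, by have := hg.1; omega⟩
    have hi := (mem_switchGaps_iff.1 hg).1
    exact mem_switchGaps_iff.2 ⟨hi, extend_alternatingSignature_ne hi⟩
  · rintro g ⟨_, _, hg⟩
    exact absurd rfl hg
  · rw [baxterCambrianNumber_eq, growth_congr (σ' := fun _ => true) m, growth_switch_one,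
      show 2 * (m + 1) - 2 = 2 * m by omega, Nat.add_sub_cancel]
    intro i hi
    exact decide_eq_true (extend_alternatingSignature_ne hi)
  · rw [baxterCambrianNumber_eq, growth_congr (σ' := fun _ => false) m, growth_same_one]
    intro i hi
    simp [extend_constantSignature]
  · rintro ⟨g, ⟨hg', hg⟩, h2, hgn⟩
    obtain ⟨t, rfl⟩ : ∃ t, g = t + 1 := ⟨g - 1, by omega⟩
    rw [mem_switchGaps_iff] at hg hg'
    rw [baxterCambrianNumber_eq, baxterCambrianNumber_eq]
    -- With `g = t + 1` and `n = m + 1`, the bounds `2 ≤ g` and `g + 2 ≤ n` are `1 ≤ t` and `t + 1 <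
    -- m`.
    refine growth_one_strict_anti (t := t) (by omega) (decide_eq_false fun h => hg ⟨hg'.1, h⟩)
      (decide_eq_true hg'.2) (by omega) (decide_ne_le_of_switchGaps h)
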